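/- Let $\mathbb{D}=\{z\in\mathbb{C}:|z|<1\}$ and let $(z_n)_{n\in\mathbb{N}}$ be a sequence of distinct points of $\mathbb{D}$. For $\zeta\in\mathbb{C}$ and $t\ge 0$ let $n_\zeta(t)\in\{0,1,2,\dots,\infty\}$ be the number of indices $k$ with $|z_k-\zeta|\le t$, and put $$N_\zeta(r)=\int_0^r\frac{(n_\zeta(t)-1)^+}{t}\,dt\in[0,\infty].$$ For $f$ analytic in $\mathbb{D}$ and $0<r<1$ write $M(r,f)=\max\{|f(z)|:|z|=r\}$. Let $\psi\colon[1,\infty)\to[0,\infty)$ be a nondecreasing unbounded function with $\psi(2x)=O(\psi(x))$ as $x\to\infty$, and let $\tilde\psi(x)=\int_1^x\frac{\psi(t)}{t}\,dt$. Let $\rho$ be the Pólya order of $\psi$, that is, the infimum of all $\rho'\ge 0$ such that $\psi(Kx)\le K^{\rho'}\psi(x)$ for all sufficiently large $x$ and $K$, and let $\sigma=\lfloor\rho\rfloor+1$. Put $$A_n(z)=\frac{1-|z_n|^2}{1-\bar z_n z},\qquad E(w,\sigma)=(1-w)\exp\Bigl(w+\tfrac{w^2}{2}+\dots+\tfrac{w^\sigma}{\sigma}\Bigr),\qquad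 P(z)=\prod_{n}E(A_n(z),\sigma),$$ where, if $z_n=0$ for some $n$, the corresponding factor of $P$ is replaced by $z$. Suppose that there is a constant $C>0$ such that $$N_{z_n}\Bigl(\frac{1-|z_n|}{2}\Bigr)\le C\,\psi\Bigl(\frac1{1-|z_n|}\Bigr)\qquad\text{for all } n.$$ Then the product $P$ converges locally uniformly in $\mathbb{D}$, $P'(z_n)\ne0$ for all $n$, and for every sequence $(b_n)$ of complex numbers for which there is $C>0$ with $$\ln|b_n|\le C\,\tilde\psi\Bigl(\frac1{1-|z_n|}\Bigr)\qquad\text{for all } n,$$ the following hold. (a) There is an analytic function $f$ in $\mathbb{D}$ with $f(z_n)=b_n$ for all $n$ and, for some $C>0$, $$\ln M(r,f)\le C\,\tilde\psi\Bigl(\frac1{1-r}\Bigr)\qquad\text{for all } r<1 \text{ sufficiently close to } 1.$$ Moreover, $f$ can be chosen in the form $$f(z)=\sum_{n}\frac{b_n}{z-z_n}\,\frac{P(z)}{P'(z_n)}\Bigl(\frac{1-|z_n|^2}{1-\bar z_n z}\Bigr)^{s_n-1},\qquad z\in\mathbb{D}\setminus\{z_k:k\in\mathbb{N}\},$$ for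 some integers $s_n\ge1$ with $s_m\le s_n$ whenever $|z_m|\le|z_n|$. (b) If $\psi(1)>0$ (that is, $\psi$ is positive), there is an analytic function $f$ in $\mathbb{D}$ with $f(z_n)=b_n$ for all $n$ and, for some $C>0$, $$\ln M(r,f)\le C\,\tilde\psi\Bigl(\frac1{1-r}\Bigr)\qquad\text{for all } r\in(0,1).$$ -/

import Mathlib

open Filter Topology Asymptotics MeasureTheory
open scoped ENNReal ComplexConjugate

noncomputable section

namespace DiscInterp

/-- `M(r, f) = max {|f(z)| : |z| = r}`. -/
def maxModulus (f : ℂ → ℂ) (r : ℝ) : ℝ :=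
  sSup ((fun w : ℂ => ‖f w‖) '' Metric.sphere (0 : ℂ) r)

/-- `n_ζ(t)`: the number (possibly infinite) of indices `k` with `|z_k - ζ| ≤ t`. -/
def countDisc (z : ℕ → ℂ) (ζ : ℂ) (t : ℝ) : ℕ∞ :=
  Set.encard {k : ℕ | ‖z k - ζ‖ ≤ t}

/-- `N_ζ(r) = ∫₀ʳ (n_ζ(t) - 1)⁺ / t dt`, a value in `[0, ∞]`
(subtraction in `ℝ≥0∞` is truncated, which is the positive part). -/
def countIntegral (z : ℕ → ℂ) (ζ : ℂ) (r : ℝ) : ℝ≥0∞ :=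
  ∫⁻ t in Set.Ioc (0 : ℝ) r, ((countDisc z ζ t : ℝ≥0∞) - 1) / ENNReal.ofReal t

/-- `ψ̃(x) = ∫₁ˣ ψ(t) / t dt`. -/
def tildeFn (ψ : ℝ → ℝ) (x : ℝ) : ℝ :=
  ∫ t in (1 : ℝ)..x, ψ t / t

/-- The order of `ψ` in the sense of Pólya: the infimum of the exponents `ρ ≥ 0` such that
`ψ(Kx) ≤ K^ρ ψ(x)` for all sufficiently large `x` and `K`. -/
def polyaOrder (ψ : ℝ → ℝ) : ℝ :=
  sInf {ρ : ℝ | 0 ≤ ρ ∧ ∃ x₀ : ℝ, 1 ≤ x₀ ∧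
    ∀ x : ℝ, x₀ ≤ x → ∀ K : ℝ, x₀ ≤ K → ψ (K * x) ≤ K ^ ρ * ψ x}

/-- The genus `s = [ρ] + 1`, where `ρ` is the Pólya order of `ψ`. -/
def genus (ψ : ℝ → ℝ) : ℕ := ⌊polyaOrder ψ⌋₊ + 1

/-- The primary factor `E(w, s) = (1 - w) exp(w + w²/2 + ⋯ + wˢ/s)`. -/
def primaryFactor (s : ℕ) (w : ℂ) : ℂ :=
  (1 - w) * Complex.exp (∑ j ∈ Finset.Icc 1 s, w ^ j / (j : ℂ))

/-- `A_a(w) = (1 - |a|²) / (1 - ā w)`. -/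
def kernelA (a w : ℂ) : ℂ :=
  (1 - ((‖a‖ ^ 2 : ℝ) : ℂ)) / (1 - conj a * w)

open Classical in
/-- The factor of the canonical product that vanishes at `a`: `E(A_a(w), s)` for `a ≠ 0`.
For `a = 0` one has `A_0 = 1` and `E(1, s) = 0`, and, as usual, the factor is `w`. -/
def canonicalFactor (s : ℕ) (a w : ℂ) : ℂ :=
  if a = 0 then w else primaryFactor s (kernelA a w)

/-- The canonical product `P(w) = ∏ₙ E(A_{zₙ}(w), s)`. -/
def canonicalProduct (z : ℕ → ℂ) (s : ℕ) (w : ℂ) : ℂ :=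
  ∏' n : ℕ, canonicalFactor s (z n) w

end DiscInterp

end

/-! Every estimate has the form `exp (C * T)`, where `T` at a point of dyadic level `J` is the sum
of `φ j = ψ (2 ^ j) + 1` over `j ≤ J`. The summand `1` lets `T` absorb constants and `log (1 / (1 -
|w|))`; since `ψ` is unbounded, `T` is still comparable to `ψ̃` near the circle. The hypothesis on
`N` gives two facts about the sequence: a disc of radius `(1 - |z_n|) / 4` about `z_n` contains
`O(φ)` points, and the sum over `k ≠ n` of `log⁺ ((1 - |z_n|) / (2 |z_k - z_n|))` is `O(φ)`.

The central estimate, `exists_sum_kernelA_le`, bounds the sum of `|A_k(w)| ^ (s + 1)` by `C * T(w)`.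
The disc is cut into polar cells with few points each; summing over angles leaves `φ j / 2 ^ (s (j -
J)⁺)`, which is summable in `j` because the genus `s` exceeds the Pólya order. This gives
convergence of `P` and its upper bound; together with the logarithmic sum it gives `|P'(z_n)| ≥ exp
(-C * T(z_n))`.

In the Lagrange series the coefficient `b_n / P'(z_n)` may be as large as `exp (C * T(z_n))`. The
power of `A_n`, which equals `1` at `z_n`, repairs this with an exponent proportional to `T(z_n)`:
if `z_n` is much closer to the circle than `w`, then `|A_n(w)| ≤ 1/2` and the power beats the
coefficient; otherwise `T(z_n) = O(T(w))` and the crude bound `|A_n| ≤ 2` suffices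
(`exists_norm_kernelA_pow_le`).

For (b), only small radii need care. There `ψ̃ (1 / (1 - r)) ≥ ψ(1) r`, so `|f(0)| ≤ 1` is enough;
when `0` is not in the sequence this is achieved by subtracting a multiple of `P`. -/

noncomputable section

namespace DiscInterp

/-! ### Dyadic levels -/

/-- The dyadic level of a point of the disc: `2 ^ level w ≤ 1 / (1 - ‖w‖) < 2 ^ (level w + 1)`. -/
def level (w : ℂ) : ℕ := Nat.log 2 ⌊1 / (1 - ‖w‖)⌋₊

theorem one_le_inv_dist {w : ℂ} (hw : ‖w‖ < 1) : 1 ≤ 1 / (1 - ‖w‖) := by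
  rw [le_div_iff₀ (by linarith)]
  linarith [norm_nonneg w]

theorem pow_level_le {w : ℂ} (hw : ‖w‖ < 1) : (2 : ℝ) ^ level w ≤ 1 / (1 - ‖w‖) := by
  have h1 := one_le_inv_dist hw
  have h2 : ⌊1 / (1 - ‖w‖)⌋₊ ≠ 0 := (Nat.floor_pos.2 h1).ne'
  have h3 := Nat.pow_log_le_self 2 h2
  have h4 : ((2 ^ level w : ℕ) : ℝ) ≤ (⌊1 / (1 - ‖w‖)⌋₊ : ℝ) := by exact_mod_cast h3
  push_cast at h4
  exact h4.trans (Nat.floor_le (by linarith))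

theorem lt_pow_level {w : ℂ} : 1 / (1 - ‖w‖) < (2 : ℝ) ^ (level w + 1) := by
  have h3 : ⌊1 / (1 - ‖w‖)⌋₊ < 2 ^ (level w + 1) :=
    Nat.lt_pow_succ_log_self (by norm_num) _
  have h4 := (Nat.floor_lt' (by positivity)).1 h3
  exact_mod_cast h4

theorem dist_mul_pow_level_le {w : ℂ} (hw : ‖w‖ < 1) : (1 - ‖w‖) * 2 ^ level w ≤ 1 := by
  have h := pow_level_le hw
  rw [le_div_iff₀ (by linarith)] at h
  linarith

theorem lt_dist_mul_pow_level {w : ℂ} (hw : ‖w‖ < 1) : 1 < (1 - ‖w‖) * 2 ^ (level w + 1) := by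
  have h := lt_pow_level (w := w)
  rw [div_lt_iff₀ (by linarith)] at h
  linarith

theorem level_le_level {v w : ℂ} (hw : ‖w‖ < 1) (h : ‖v‖ ≤ ‖w‖) : level v ≤ level w := by
  refine Nat.log_mono_right (Nat.floor_le_floor ?_)
  exact one_div_le_one_div_of_le (by linarith) (by linarith)

theorem level_le_of_dist_le {v w : ℂ} (hw : ‖w‖ < 1) (hv : ‖v‖ < 1) {m : ℕ}
    (h : 1 - ‖v‖ ≤ 2 ^ m * (1 - ‖w‖)) : level w ≤ level v + m := by
  have h1 := dist_mul_pow_level_le hw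
  have h2 := lt_dist_mul_pow_level hv
  have h3 : (2 : ℝ) ^ level w < 2 ^ (level v + m + 1) := by
    have : (1 - ‖v‖) * 2 ^ (level v + 1) * 2 ^ level w ≤ 2 ^ (level v + m + 1) := by
      calc (1 - ‖v‖) * 2 ^ (level v + 1) * 2 ^ level w
          ≤ (2 ^ m * (1 - ‖w‖)) * 2 ^ (level v + 1) * 2 ^ level w := by gcongr
        _ = 2 ^ (level v + m + 1) * ((1 - ‖w‖) * 2 ^ level w) := by ring
        _ ≤ 2 ^ (level v + m + 1) * 1 := by gcongr
        _ = _ := by ring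
    refine lt_of_lt_of_le ?_ this
    exact lt_mul_of_one_lt_left (by positivity) h2
  have := (pow_lt_pow_iff_right₀ (by norm_num : (1 : ℝ) < 2)).1 h3
  omega

/-! ### Dyadic growth sequences -/

/-- The values of `ψ + 1` at the powers of two. -/
def dyadic (ψ : ℝ → ℝ) (j : ℕ) : ℝ := ψ (2 ^ j) + 1

/-- The partial sums of a sequence, last index included. -/
def partialSum (φ : ℕ → ℝ) (J : ℕ) : ℝ := ∑ j ∈ Finset.range (J + 1), φ j

/-- Nondecreasing sequences `φ ≥ 1` that grow at most like `q ^ j` for some `q < 2 ^ s`. -/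
structure IsGrowth (φ : ℕ → ℝ) (s : ℕ) : Prop where
  one_le : ∀ j, 1 ≤ φ j
  mono : Monotone φ
  exists_ratio : ∃ C q : ℝ, 0 < C ∧ 1 ≤ q ∧ q < 2 ^ s ∧ ∀ i j, φ (j + i) ≤ C * q ^ i * φ j

section Growth

variable {φ : ℕ → ℝ} {s : ℕ}

theorem partialSum_mono (h : IsGrowth φ s) : Monotone (partialSum φ) := by
  intro a b hab
  refine Finset.sum_le_sum_of_subset_of_nonneg ?_ fun j _ _ => by linarith [h.one_le j]
  exact Finset.range_mono (by omega)

theorem succ_le_partialSum (h : IsGrowth φ s) (J : ℕ) : (J + 1 : ℝ) ≤ partialSum φ J := by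
  have : ∑ j ∈ Finset.range (J + 1), (1 : ℝ) ≤ partialSum φ J :=
    Finset.sum_le_sum fun j _ => h.one_le j
  simpa using this

theorem one_le_partialSum (h : IsGrowth φ s) (J : ℕ) : 1 ≤ partialSum φ J := by
  have := succ_le_partialSum h J
  have h2 : (0 : ℝ) ≤ J := J.cast_nonneg
  linarith

theorem le_partialSum (h : IsGrowth φ s) (J : ℕ) : φ J ≤ partialSum φ J :=
  Finset.single_le_sum (f := φ) (fun j _ => by linarith [h.one_le j])
    (Finset.mem_range.2 (Nat.lt_succ_self J))

theorem exists_partialSum_add_le (h : IsGrowth φ s) :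
    ∃ D : ℝ, 1 ≤ D ∧ ∀ i J, partialSum φ (J + i) ≤ D ^ i * partialSum φ J := by
  obtain ⟨C, q, hC, hq, -, hr⟩ := h.exists_ratio
  refine ⟨1 + C * q, by nlinarith, fun i J => ?_⟩
  induction i with
  | zero => simp
  | succ i ih =>
    have h1 : partialSum φ (J + (i + 1)) = partialSum φ (J + i) + φ (J + i + 1) := by
      rw [← add_assoc, partialSum, Finset.sum_range_succ, partialSum]
    have h2 := hr 1 (J + i)
    rw [pow_one] at h2
    have h3 := le_partialSum h (J + i)
    have h4 : C * q * φ (J + i) ≤ C * q * partialSum φ (J + i) := by gcongr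
    calc partialSum φ (J + (i + 1)) ≤ (1 + C * q) * partialSum φ (J + i) := by linarith
      _ ≤ (1 + C * q) * ((1 + C * q) ^ i * partialSum φ J) := by gcongr
      _ = _ := by ring

/-- A growth sequence damped by `2 ^ (-s (j - J)⁺)` is summable, with sum controlled by the
partial sum up to `J`. -/
theorem exists_sum_damped_le (h : IsGrowth φ s) :
    ∃ C : ℝ, 0 < C ∧ ∀ J N, ∑ j ∈ Finset.range N, φ j / ((2 : ℝ) ^ (j - J)) ^ s
      ≤ C * partialSum φ J := by
  obtain ⟨C, q, hC, hq, hqs, hr⟩ := h.exists_ratio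
  have hq0 : 0 ≤ q := by linarith
  have hlt : q / 2 ^ s < 1 := by rw [div_lt_one (by positivity)]; exact hqs
  have h0 : 0 ≤ q / 2 ^ s := by positivity
  have hpos : 0 < (1 - q / 2 ^ s)⁻¹ := inv_pos.2 (by linarith)
  refine ⟨1 + C * (1 - q / 2 ^ s)⁻¹, by positivity, fun J N => ?_⟩
  have hterm : ∀ j, 0 ≤ φ j / ((2 : ℝ) ^ (j - J)) ^ s := fun j => by
    have := h.one_le j
    positivity
  -- Subtraction in `ℕ` is truncated: levels up to `J` are undamped and give `partialSum φ J`;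
  -- beyond `J` a geometric series of ratio `q / 2 ^ s < 1` dominates.
  calc ∑ j ∈ Finset.range N, φ j / ((2 : ℝ) ^ (j - J)) ^ s
      ≤ ∑ j ∈ Finset.range (J + 1 + N), φ j / ((2 : ℝ) ^ (j - J)) ^ s :=
        Finset.sum_le_sum_of_subset_of_nonneg (Finset.range_mono (by omega))
          fun j _ _ => hterm j
    _ = ∑ j ∈ Finset.range (J + 1), φ j / ((2 : ℝ) ^ (j - J)) ^ s
        + ∑ i ∈ Finset.range N, φ (J + 1 + i) / ((2 : ℝ) ^ (J + 1 + i - J)) ^ s := by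
        rw [Finset.sum_range_add]
    _ ≤ partialSum φ J + C * (1 - q / 2 ^ s)⁻¹ * φ J := by
        gcongr
        · refine (Finset.sum_congr rfl fun j hj => ?_).le
          have : j - J = 0 := by have := Finset.mem_range.1 hj; omega
          simp [this]
        · calc ∑ i ∈ Finset.range N, φ (J + 1 + i) / ((2 : ℝ) ^ (J + 1 + i - J)) ^ s
              ≤ ∑ i ∈ Finset.range N, C * φ J * (q / 2 ^ s) ^ i := by
                refine Finset.sum_le_sum fun i _ => ?_
                have e : J + 1 + i - J = i + 1 := by omega
                have h1 := hr (i + 1) J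
                rw [show J + 1 + i = J + (i + 1) by ring, show J + (i + 1) - J = i + 1 by omega]
                calc φ (J + (i + 1)) / ((2 : ℝ) ^ (i + 1)) ^ s
                    ≤ C * q ^ (i + 1) * φ J / ((2 : ℝ) ^ (i + 1)) ^ s := by gcongr
                  _ = C * φ J * (q / 2 ^ s) ^ i * (q / 2 ^ s) := by
                    rw [← pow_mul, mul_comm (i + 1) s, pow_mul, pow_succ q, pow_succ ((2 : ℝ) ^ s),
                      div_pow]
                    field_simp
                  _ ≤ C * φ J * (q / 2 ^ s) ^ i * 1 := by
                    have := h.one_le J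
                    gcongr
                  _ = _ := by ring
            _ = C * φ J * ∑ i ∈ Finset.range N, (q / 2 ^ s) ^ i := by rw [Finset.mul_sum]
            _ ≤ C * φ J * (1 - q / 2 ^ s)⁻¹ := by
                have := h.one_le J
                gcongr
                rw [← tsum_geometric_of_lt_one h0 hlt]
                exact (summable_geometric_of_lt_one h0 hlt).sum_le_tsum _
                  fun i _ => by positivity
            _ = _ := by ring
    _ ≤ partialSum φ J + C * (1 - q / 2 ^ s)⁻¹ * partialSum φ J := by
        gcongr
        exact le_partialSum h J
    _ = _ := by ring

end Growth

/-! ### The Pólya order -/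

section Polya

variable {ψ : ℝ → ℝ}

/-- Iterated doubling gives a power bound. Without it the infimum defining the order would be the
default value `sInf ∅ = 0` and would say nothing about `ψ`. -/
theorem polyaOrder_set_nonempty (hψ_nonneg : ∀ x : ℝ, 1 ≤ x → 0 ≤ ψ x)
    (hψ_mono : MonotoneOn ψ (Set.Ici 1))
    (hψ_polya : (fun x : ℝ => ψ (2 * x)) =O[atTop] ψ) :
    {ρ : ℝ | 0 ≤ ρ ∧ ∃ x₀ : ℝ, 1 ≤ x₀ ∧
      ∀ x : ℝ, x₀ ≤ x → ∀ K : ℝ, x₀ ≤ K → ψ (K * x) ≤ K ^ ρ * ψ x}.Nonempty := by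
  obtain ⟨c, hc⟩ := hψ_polya.bound
  obtain ⟨X, hX⟩ := eventually_atTop.1 hc
  obtain ⟨a, ha⟩ := pow_unbounded_of_one_lt c (by norm_num : (1 : ℝ) < 2)
  have hdouble : ∀ x, max X 1 ≤ x → ψ (2 * x) ≤ 2 ^ a * ψ x := fun x hx => by
    have h1 : 1 ≤ x := (le_max_right _ _).trans hx
    have h := hX x ((le_max_left _ _).trans hx)
    rw [Real.norm_of_nonneg (hψ_nonneg _ (by linarith)),
      Real.norm_of_nonneg (hψ_nonneg _ h1)] at h
    exact h.trans (mul_le_mul_of_nonneg_right ha.le (hψ_nonneg _ h1))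
  have hiter : ∀ (k : ℕ) x, max X 1 ≤ x → ψ (2 ^ k * x) ≤ (2 ^ a) ^ k * ψ x := by
    intro k x hx
    have h1 : 1 ≤ x := (le_max_right _ _).trans hx
    induction k with
    | zero => simp
    | succ k ih =>
      have h2 : x ≤ 2 ^ k * x := le_mul_of_one_le_left (by linarith) (one_le_pow₀ (by norm_num))
      calc ψ (2 ^ (k + 1) * x) = ψ (2 * (2 ^ k * x)) := by ring_nf
        _ ≤ 2 ^ a * ψ (2 ^ k * x) := hdouble _ (hx.trans h2)
        _ ≤ 2 ^ a * ((2 ^ a) ^ k * ψ x) := by gcongr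
        _ = _ := by ring
  refine ⟨2 * a, by positivity, max (max X 1) 2, by simp, fun x hx K hK => ?_⟩
  have hx1 : max X 1 ≤ x := (le_max_left _ _).trans hx
  have h1 : 1 ≤ x := (le_max_right _ _).trans hx1
  have hK2 : 2 ≤ K := (le_max_right _ _).trans hK
  obtain ⟨k, hk1, hk2⟩ := exists_nat_pow_near (show 1 ≤ K by linarith) (by norm_num : (1 : ℝ) < 2)
  have hKx : 1 ≤ K * x := by nlinarith
  calc ψ (K * x) ≤ ψ (2 ^ (k + 1) * x) := by
        refine hψ_mono hKx ?_ (by gcongr)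
        exact hKx.trans (by gcongr)
    _ ≤ (2 ^ a) ^ (k + 1) * ψ x := hiter _ x hx1
    _ ≤ K ^ (2 * a : ℝ) * ψ x := by
        have := hψ_nonneg x h1
        gcongr
        have h3 : (2 : ℝ) ^ (k + 1) ≤ K ^ 2 := by
          rw [pow_succ, sq]
          gcongr
        calc ((2 : ℝ) ^ a) ^ (k + 1) = (2 ^ (k + 1)) ^ a := by rw [← pow_mul, ← pow_mul, mul_comm]
          _ ≤ (K ^ 2) ^ a := by gcongr
          _ = K ^ (2 * a : ℝ) := by
            rw [← pow_mul, show (2 * a : ℝ) = ((2 * a : ℕ) : ℝ) by push_cast; ring,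
              Real.rpow_natCast]

/-- The genus is strictly above the Pólya order, so some admissible exponent `ρ` is below it, and `q
= 2 ^ ρ < 2 ^ genus`. -/
theorem isGrowth_dyadic (hψ_nonneg : ∀ x : ℝ, 1 ≤ x → 0 ≤ ψ x)
    (hψ_mono : MonotoneOn ψ (Set.Ici 1))
    (hψ_polya : (fun x : ℝ => ψ (2 * x)) =O[atTop] ψ) :
    IsGrowth (dyadic ψ) (genus ψ) := by
  have hpow : ∀ j : ℕ, (1 : ℝ) ≤ 2 ^ j := fun j => one_le_pow₀ (by norm_num)
  have hone : ∀ j, 1 ≤ dyadic ψ j := fun j => by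
    have := hψ_nonneg _ (hpow j)
    unfold dyadic
    linarith
  have hmono : Monotone (dyadic ψ) := fun i j hij => by
    have := hψ_mono (hpow i) (hpow j) (pow_le_pow_right₀ (by norm_num) hij)
    unfold dyadic
    linarith
  have hlt : polyaOrder ψ < (genus ψ : ℝ) := by
    unfold genus
    push_cast
    exact Nat.lt_floor_add_one _
  obtain ⟨ρ, ⟨hρ0, x₀, hx₀, hρ⟩, hρs⟩ := exists_lt_of_csInf_lt
    (polyaOrder_set_nonempty hψ_nonneg hψ_mono hψ_polya) hlt
  obtain ⟨m, hm⟩ := pow_unbounded_of_one_lt x₀ (by norm_num : (1 : ℝ) < 2)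
  obtain ⟨c, hc⟩ := hψ_polya.bound
  obtain ⟨X, hX⟩ := eventually_atTop.1 hc
  obtain ⟨p, hp⟩ := pow_unbounded_of_one_lt X (by norm_num : (1 : ℝ) < 2)
  -- One-step growth constant: the doubling condition supplies `c` from index `p` on, and below `p`
  -- monotonicity and `1 ≤ dyadic ψ j` allow the single value at `p + 1`.
  set D : ℝ := max (max c 1) (dyadic ψ (p + 1)) with hD
  have hD1 : 1 ≤ D := (le_max_right c 1).trans (le_max_left _ _)
  have hstep : ∀ j, dyadic ψ (j + 1) ≤ D * dyadic ψ j := fun j => by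
    rcases le_total j p with hj | hj
    · calc dyadic ψ (j + 1) ≤ dyadic ψ (p + 1) := hmono (by omega)
        _ ≤ D * 1 := by rw [mul_one]; exact le_max_right _ _
        _ ≤ D * dyadic ψ j := by gcongr; exact hone j
    · have h1 := hX (2 ^ j) (hp.le.trans (pow_le_pow_right₀ (by norm_num) hj))
      have h0 := hψ_nonneg _ (hpow j)
      rw [Real.norm_of_nonneg (hψ_nonneg _ (by linarith [hpow j])), Real.norm_of_nonneg h0] at h1
      have hcD : c ≤ D := (le_max_left c 1).trans (le_max_left _ _)
      unfold dyadic
      rw [pow_succ, mul_comm ((2 : ℝ) ^ j)]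
      nlinarith
  have hiter : ∀ i j, dyadic ψ (j + i) ≤ D ^ i * dyadic ψ j := fun i j => by
    induction i with
    | zero => simp
    | succ i ih =>
      calc dyadic ψ (j + i + 1) ≤ D * dyadic ψ (j + i) := hstep _
        _ ≤ D * (D ^ i * dyadic ψ j) := by gcongr
        _ = _ := by ring
  have hq : (1 : ℝ) ≤ 2 ^ ρ := Real.one_le_rpow (by norm_num) hρ0
  refine ⟨hone, hmono, (2 ^ ρ) ^ m * D ^ m, 2 ^ ρ, by positivity, hq, ?_, fun i j => ?_⟩
  · rw [← Real.rpow_natCast]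
    exact Real.rpow_lt_rpow_of_exponent_lt (by norm_num) hρs
  -- The power bound needs both arguments beyond `x₀ < 2 ^ m`, so both indices are shifted by `m`;
  -- the shift in `j` is undone at the cost of `D ^ m`.
  · have h1 := hρ (2 ^ (j + m)) (hm.le.trans (pow_le_pow_right₀ (by norm_num) (by omega)))
      (2 ^ (i + m)) (hm.le.trans (pow_le_pow_right₀ (by norm_num) (by omega)))
    have h2 : ((2 : ℝ) ^ (i + m)) ^ ρ = (2 ^ ρ) ^ (i + m) := by
      rw [← Real.rpow_natCast, ← Real.rpow_natCast, ← Real.rpow_mul (by norm_num),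
        ← Real.rpow_mul (by norm_num), mul_comm]
    have hqi : (1 : ℝ) ≤ (2 ^ ρ) ^ (i + m) := one_le_pow₀ hq
    calc dyadic ψ (j + i) ≤ dyadic ψ ((i + m) + (j + m)) := hmono (by omega)
      _ = ψ (2 ^ (i + m) * 2 ^ (j + m)) + 1 := by rw [dyadic, pow_add]
      _ ≤ (2 ^ ρ) ^ (i + m) * ψ (2 ^ (j + m)) + (2 ^ ρ) ^ (i + m) := by
          rw [← h2]
          rw [← h2] at hqi
          gcongr
      _ = (2 ^ ρ) ^ (i + m) * dyadic ψ (j + m) := by rw [dyadic]; ring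
      _ ≤ (2 ^ ρ) ^ (i + m) * (D ^ m * dyadic ψ j) := by gcongr; exact hiter m j
      _ = _ := by ring

/-! ### Comparison of `ψ̃` with dyadic sums -/

theorem intervalIntegrable_div (hψ_mono : MonotoneOn ψ (Set.Ici 1)) {a b : ℝ} (ha : 1 ≤ a)
    (hb : 1 ≤ b) : IntervalIntegrable (fun t => ψ t / t) volume a b := by
  have hsub : Set.uIcc a b ⊆ Set.Ici 1 := fun t ht => (le_min ha hb).trans ht.1
  simp only [div_eq_mul_inv]
  refine (hψ_mono.mono hsub).intervalIntegrable.mul_continuousOn ?_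
  exact continuousOn_id.inv₀ fun t ht => by
    have : (1 : ℝ) ≤ t := hsub ht
    simp only [id]
    linarith

theorem tildeFn_mono (hψ_nonneg : ∀ x : ℝ, 1 ≤ x → 0 ≤ ψ x)
    (hψ_mono : MonotoneOn ψ (Set.Ici 1)) {x y : ℝ} (hx : 1 ≤ x) (hxy : x ≤ y) :
    tildeFn ψ x ≤ tildeFn ψ y := by
  unfold tildeFn
  rw [← intervalIntegral.integral_add_adjacent_intervals
    (intervalIntegrable_div hψ_mono le_rfl hx)
    (intervalIntegrable_div hψ_mono hx (hx.trans hxy))]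
  refine le_add_of_nonneg_right (intervalIntegral.integral_nonneg hxy fun t ht => ?_)
  have h1 : 1 ≤ t := hx.trans ht.1
  have := hψ_nonneg t h1
  positivity

theorem integral_div_le {c : ℝ} (hψ_mono : MonotoneOn ψ (Set.Ici 1)) {a b : ℝ} (ha : 1 ≤ a)
    (hab : a ≤ b) (hc : ∀ t ∈ Set.Icc a b, ψ t ≤ c) :
    ∫ t in a..b, ψ t / t ≤ c * Real.log (b / a) := by
  have hb := ha.trans hab
  rw [← integral_inv_of_pos (by linarith) (by linarith), ← intervalIntegral.integral_const_mul]
  refine intervalIntegral.integral_mono_on hab (intervalIntegrable_div hψ_mono ha hb) ?_ ?_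
  · exact (intervalIntegrable_inv_iff.2 (Or.inr fun h => by
      rw [Set.uIcc_of_le hab] at h; linarith [h.1])).const_mul c
  · intro t ht
    rw [div_eq_mul_inv]
    have : 1 ≤ t := ha.trans ht.1
    exact mul_le_mul_of_nonneg_right (hc t ht) (by positivity)

theorem le_integral_div {c : ℝ} (hψ_mono : MonotoneOn ψ (Set.Ici 1)) {a b : ℝ} (ha : 1 ≤ a)
    (hab : a ≤ b) (hc : ∀ t ∈ Set.Icc a b, c ≤ ψ t) :
    c * Real.log (b / a) ≤ ∫ t in a..b, ψ t / t := by
  have hb := ha.trans hab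
  rw [← integral_inv_of_pos (by linarith) (by linarith), ← intervalIntegral.integral_const_mul]
  refine intervalIntegral.integral_mono_on hab ?_ (intervalIntegrable_div hψ_mono ha hb) ?_
  · exact (intervalIntegrable_inv_iff.2 (Or.inr fun h => by
      rw [Set.uIcc_of_le hab] at h; linarith [h.1])).const_mul c
  · intro t ht
    rw [div_eq_mul_inv]
    have : 1 ≤ t := ha.trans ht.1
    exact mul_le_mul_of_nonneg_right (hc t ht) (by positivity)

theorem tildeFn_two_pow (hψ_mono : MonotoneOn ψ (Set.Ici 1)) (J : ℕ) :
    tildeFn ψ (2 ^ J) = ∑ j ∈ Finset.range J, ∫ t in (2 ^ j : ℝ)..2 ^ (j + 1), ψ t / t := by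
  have h := intervalIntegral.sum_integral_adjacent_intervals (f := fun t => ψ t / t)
    (μ := volume) (a := fun j : ℕ => (2 : ℝ) ^ j) (n := J) fun k _ =>
      intervalIntegrable_div hψ_mono (one_le_pow₀ (by norm_num)) (one_le_pow₀ (by norm_num))
  simp only [pow_zero] at h
  exact h.symm

theorem tildeFn_le_partialSum (hψ_nonneg : ∀ x : ℝ, 1 ≤ x → 0 ≤ ψ x)
    (hψ_mono : MonotoneOn ψ (Set.Ici 1)) (hg : IsGrowth (dyadic ψ) (genus ψ))
    {w : ℂ} (hw : ‖w‖ < 1) :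
    tildeFn ψ (1 / (1 - ‖w‖)) ≤ partialSum (dyadic ψ) (level w + 1) := by
  have hpow : ∀ j : ℕ, (1 : ℝ) ≤ 2 ^ j := fun j => one_le_pow₀ (by norm_num)
  refine (tildeFn_mono hψ_nonneg hψ_mono (one_le_inv_dist hw) lt_pow_level.le).trans ?_
  -- The integral over `[2 ^ j, 2 ^ (j + 1)]` is bounded through the right endpoint, so it is
  -- matched with term `j + 1` and term `0` is split off.
  rw [tildeFn_two_pow hψ_mono, partialSum, Finset.sum_range_succ' (dyadic ψ)]
  refine le_add_of_le_of_nonneg (Finset.sum_le_sum fun j _ => ?_) (by linarith [hg.one_le 0])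
  have hle : (2 : ℝ) ^ j ≤ 2 ^ (j + 1) := pow_le_pow_right₀ (by norm_num) (by omega)
  refine (integral_div_le hψ_mono (hpow j) hle (c := ψ (2 ^ (j + 1))) ?_).trans ?_
  · exact fun t ht => hψ_mono ((hpow j).trans ht.1) (hpow _) ht.2
  · have h2 : (2 : ℝ) ^ (j + 1) / 2 ^ j = 2 := by rw [pow_succ]; field_simp
    have h0 := hψ_nonneg _ (hpow (j + 1))
    rw [h2, dyadic]
    nlinarith [Real.log_two_lt_d9]

/-- Once `ψ (2 ^ p) ≥ 1`, later terms satisfy `ψ + 1 ≤ 2 ψ`, and the initial terms are a constant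
times something at least `1`. The integral up to `2 ^ level w` misses the top term, which costs a
factor `D`; the last factor `2` comes from `log 2 ≥ 1/2`. -/
theorem exists_partialSum_le_tildeFn (hψ_nonneg : ∀ x : ℝ, 1 ≤ x → 0 ≤ ψ x)
    (hψ_mono : MonotoneOn ψ (Set.Ici 1)) (hψ_unbdd : ¬ BddAbove (ψ '' Set.Ici 1))
    (hg : IsGrowth (dyadic ψ) (genus ψ)) :
    ∃ C : ℝ, 0 < C ∧ ∃ J₀ : ℕ, ∀ w : ℂ, ‖w‖ < 1 → J₀ ≤ level w →
      partialSum (dyadic ψ) (level w) ≤ C * tildeFn ψ (1 / (1 - ‖w‖)) := by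
  have hpow : ∀ j : ℕ, (1 : ℝ) ≤ 2 ^ j := fun j => one_le_pow₀ (by norm_num)
  obtain ⟨D, hD, hstep⟩ := exists_partialSum_add_le hg
  obtain ⟨x, hx, hψx⟩ : ∃ x, 1 ≤ x ∧ 1 ≤ ψ x := by
    by_contra! hcon
    refine hψ_unbdd ⟨1, ?_⟩
    rintro _ ⟨x, hx, rfl⟩
    exact (hcon x hx).le
  obtain ⟨p, hp⟩ := pow_unbounded_of_one_lt x (by norm_num : (1 : ℝ) < 2)
  have hψp : ∀ j, p ≤ j → 1 ≤ ψ (2 ^ j) := fun j hj =>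
    hψx.trans (hψ_mono hx (hpow j) (hp.le.trans (pow_le_pow_right₀ (by norm_num) hj)))
  have hT := one_le_partialSum hg p
  refine ⟨D * (partialSum (dyadic ψ) p + 2) * 2, by positivity, p + 1, fun w hw hJ => ?_⟩
  obtain ⟨i, hi⟩ : ∃ i, level w = p + i + 1 := ⟨level w - p - 1, by omega⟩
  have htilde : (∑ j ∈ Finset.range (p + i + 1), ψ (2 ^ j)) / 2
      ≤ tildeFn ψ (1 / (1 - ‖w‖)) := by
    refine le_trans ?_ (tildeFn_mono hψ_nonneg hψ_mono (hpow (level w)) (pow_level_le hw))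
    rw [tildeFn_two_pow hψ_mono, Finset.sum_div, hi]
    refine Finset.sum_le_sum fun j _ => ?_
    have hle : (2 : ℝ) ^ j ≤ 2 ^ (j + 1) := pow_le_pow_right₀ (by norm_num) (by omega)
    refine le_trans ?_ (le_integral_div hψ_mono (hpow j) hle (c := ψ (2 ^ j)) ?_)
    · have h2 : (2 : ℝ) ^ (j + 1) / 2 ^ j = 2 := by rw [pow_succ]; field_simp
      have h0 := hψ_nonneg _ (hpow j)
      rw [h2]
      nlinarith [Real.log_two_gt_d9]
    · exact fun t ht => hψ_mono (hpow j) ((hpow j).trans ht.1) ht.1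
  have hsum1 : 1 ≤ ∑ j ∈ Finset.range (p + i + 1), ψ (2 ^ j) := by
    refine (hψp p le_rfl).trans ?_
    exact Finset.single_le_sum (f := fun j : ℕ => ψ (2 ^ j))
      (fun j _ => hψ_nonneg _ (hpow j)) (Finset.mem_range.2 (by omega))
  have hsplit : partialSum (dyadic ψ) (p + i)
      ≤ partialSum (dyadic ψ) p + 2 * ∑ j ∈ Finset.range (p + i + 1), ψ (2 ^ j) := by
    rw [partialSum, partialSum, show p + i + 1 = p + 1 + i by ring,
      Finset.sum_range_add (dyadic ψ), Finset.sum_range_add (fun j : ℕ => ψ (2 ^ j)), mul_add]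
    have h1 : 0 ≤ ∑ j ∈ Finset.range (p + 1), ψ (2 ^ j) :=
      Finset.sum_nonneg fun j _ => hψ_nonneg _ (hpow j)
    have h2 : ∑ j ∈ Finset.range i, dyadic ψ (p + 1 + j)
        ≤ 2 * ∑ j ∈ Finset.range i, ψ (2 ^ (p + 1 + j)) := by
      rw [Finset.mul_sum]
      refine Finset.sum_le_sum fun j _ => ?_
      have := hψp (p + 1 + j) (by omega)
      unfold dyadic
      linarith
    linarith
  have h1 := hstep 1 (p + i)
  rw [← hi, pow_one] at h1
  calc partialSum (dyadic ψ) (level w) ≤ D * partialSum (dyadic ψ) (p + i) := h1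
    _ ≤ D * ((partialSum (dyadic ψ) p + 2) * ∑ j ∈ Finset.range (p + i + 1), ψ (2 ^ j)) := by
        gcongr
        nlinarith
    _ ≤ D * ((partialSum (dyadic ψ) p + 2) * (2 * tildeFn ψ (1 / (1 - ‖w‖)))) := by
        gcongr
        linarith
    _ = _ := by ring

end Polya

/-! ### Counting points near a point of the sequence -/

section Counting

variable {z : ℕ → ℂ}

/-- On `(r, 2r]` the integrand is at least `(n_ζ(r) - 1) / (2r)`. -/
theorem countDisc_sub_one_le {ζ : ℂ} {r : ℝ} (hr : 0 < r) :
    (countDisc z ζ r : ℝ≥0∞) - 1 ≤ 2 * countIntegral z ζ (2 * r) := by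
  have hmono : ∀ t, r ≤ t → countDisc z ζ r ≤ countDisc z ζ t := fun t ht =>
    Set.encard_le_encard fun k (hk : _ ≤ r) => hk.trans ht
  have h1 : ∫⁻ _ in Set.Ioc r (2 * r), ((countDisc z ζ r : ℝ≥0∞) - 1) / ENNReal.ofReal (2 * r)
      ≤ countIntegral z ζ (2 * r) := by
    refine (setLIntegral_mono' measurableSet_Ioc fun t ht => ?_).trans
      (lintegral_mono_set (Set.Ioc_subset_Ioc_left hr.le))
    gcongr
    · exact hmono t ht.1.le
    · exact ht.2
  rw [setLIntegral_const, Real.volume_Ioc, ENNReal.div_eq_inv_mul] at h1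
  have h2 : (2 : ℝ≥0∞) * ((ENNReal.ofReal (2 * r))⁻¹ * ((countDisc z ζ r : ℝ≥0∞) - 1) *
      ENNReal.ofReal (2 * r - r)) = (countDisc z ζ r : ℝ≥0∞) - 1 := by
    have h3 : ENNReal.ofReal (2 * r) = 2 * ENNReal.ofReal (2 * r - r) := by
      rw [show 2 * r - r = r by ring, ENNReal.ofReal_mul (by norm_num)]
      simp
    have h4 : ENNReal.ofReal (2 * r) ≠ 0 := by simpa using hr
    calc _ = ((ENNReal.ofReal (2 * r))⁻¹ * (2 * ENNReal.ofReal (2 * r - r))) *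
          ((countDisc z ζ r : ℝ≥0∞) - 1) := by ring
      _ = _ := by rw [← h3, ENNReal.inv_mul_cancel h4 ENNReal.ofReal_ne_top, one_mul]
  rw [← h2]
  gcongr

theorem ofReal_posLog_le {a R : ℝ} (ha : 0 < a) (hR : 0 ≤ R) :
    ENNReal.ofReal (Real.posLog (R / a)) ≤
      ∫⁻ t in Set.Ioc (0 : ℝ) R, (if a ≤ t then 1 else 0) / ENNReal.ofReal t := by
  rcases le_total R a with h | h
  · have h0 : Real.posLog (R / a) = 0 := by
      rw [Real.posLog_eq_zero_iff, abs_of_nonneg (by positivity), div_le_one ha]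
      exact h
    simp [h0]
  · have h1 : Real.posLog (R / a) = ∫ t in Set.Ioc a R, t⁻¹ := by
      rw [← intervalIntegral.integral_of_le h, integral_inv_of_pos ha (ha.trans_le h),
        Real.posLog_eq_log]
      rw [abs_of_nonneg (by positivity), le_div_iff₀ ha]
      linarith
    have hint : IntegrableOn (fun t : ℝ => t⁻¹) (Set.Ioc a R) := by
      rw [← intervalIntegrable_iff_integrableOn_Ioc_of_le h]
      exact intervalIntegrable_inv_iff.2 (Or.inr fun h' => by
        rw [Set.uIcc_of_le h] at h'; linarith [h'.1])
    rw [h1, ofReal_integral_eq_lintegral_ofReal hint]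
    · refine (setLIntegral_mono' measurableSet_Ioc fun t ht => ?_).trans
        (lintegral_mono_set (Set.Ioc_subset_Ioc_left ha.le))
      have ht0 : 0 < t := ha.trans ht.1
      rw [if_pos ht.1.le, ENNReal.ofReal_inv_of_pos ht0, one_div]
    · filter_upwards [ae_restrict_mem measurableSet_Ioc] with t ht
      exact inv_nonneg.2 (ha.trans ht.1).le

/-- Each `log⁺ (R / a)` is the integral of `1/t` over `a ≤ t ≤ R`, so the sum is the integral of a
counting function that omits `z n`; this is what the `-1` in `N` accounts for. -/
theorem sum_posLog_le (hz_inj : Function.Injective z) (n : ℕ) {R : ℝ} (hR : 0 ≤ R) (S : Finset ℕ)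
    (hS : n ∉ S) :
    ENNReal.ofReal (∑ k ∈ S, Real.posLog (R / ‖z k - z n‖)) ≤ countIntegral z (z n) R := by
  rw [ENNReal.ofReal_sum_of_nonneg fun k _ => Real.posLog_nonneg]
  have hmeas : ∀ k : ℕ, Measurable fun t : ℝ =>
      (if ‖z k - z n‖ ≤ t then (1 : ℝ≥0∞) else 0) / ENNReal.ofReal t := fun k =>
    (Measurable.ite measurableSet_Ici measurable_const measurable_const).div
      ENNReal.measurable_ofReal
  calc ∑ k ∈ S, ENNReal.ofReal (Real.posLog (R / ‖z k - z n‖))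
      ≤ ∑ k ∈ S, ∫⁻ t in Set.Ioc (0 : ℝ) R,
          (if ‖z k - z n‖ ≤ t then 1 else 0) / ENNReal.ofReal t := by
        refine Finset.sum_le_sum fun k hk => ofReal_posLog_le ?_ hR
        exact norm_pos_iff.2 (sub_ne_zero.2 (hz_inj.ne (ne_of_mem_of_not_mem hk hS)))
    _ = ∫⁻ t in Set.Ioc (0 : ℝ) R, ∑ k ∈ S,
          (if ‖z k - z n‖ ≤ t then 1 else 0) / ENNReal.ofReal t :=
        (lintegral_finsetSum _ fun k _ => hmeas k).symm
    _ ≤ countIntegral z (z n) R := by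
        refine setLIntegral_mono' measurableSet_Ioc fun t ht => ?_
        simp only [div_eq_mul_inv]
        rw [← Finset.sum_mul]
        gcongr
        rw [Finset.sum_ite, Finset.sum_const_zero, add_zero, Finset.sum_const, nsmul_one]
        refine ENNReal.le_sub_of_add_le_right ENNReal.one_ne_top ?_
        have hn : n ∉ S.filter fun k => ‖z k - z n‖ ≤ t := fun h =>
          hS (Finset.mem_filter.1 h).1
        have h1 : (((insert n (S.filter fun k => ‖z k - z n‖ ≤ t) : Finset ℕ) : Set ℕ)).encard
            ≤ countDisc z (z n) t := by
          refine Set.encard_le_encard fun k hk => ?_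
          rcases Finset.mem_insert.1 (Finset.mem_coe.1 hk) with rfl | hk
          · simpa using ht.1.le
          · exact (Finset.mem_filter.1 hk).2
        rw [Set.encard_coe_eq_coe_finsetCard, Finset.card_insert_of_notMem hn] at h1
        have h2 := ENat.toENNReal_le.2 h1
        simpa using h2

variable {φ : ℕ → ℝ} {s : ℕ}

/-- The points of a sequence in the disc have density and separation controlled by `φ`. -/
structure IsSparse (z : ℕ → ℂ) (φ : ℕ → ℝ) : Prop where
  norm_lt_one : ∀ n, ‖z n‖ < 1
  injective : Function.Injective z
  exists_card_le : ∃ C : ℝ, 0 < C ∧ ∀ n, ∀ S : Finset ℕ,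
    (∀ k ∈ S, ‖z k - z n‖ ≤ (1 - ‖z n‖) / 4) → (S.card : ℝ) ≤ C * φ (level (z n))
  exists_sum_posLog_le : ∃ C : ℝ, 0 < C ∧ ∀ n, ∀ S : Finset ℕ, n ∉ S →
    ∑ k ∈ S, Real.posLog ((1 - ‖z n‖) / 2 / ‖z k - z n‖) ≤ C * φ (level (z n))

theorem isSparse {ψ : ℝ → ℝ} (hz_inj : Function.Injective z) (hz_disc : ∀ n, ‖z n‖ < 1)
    (hψ_mono : MonotoneOn ψ (Set.Ici 1)) (hg : IsGrowth (dyadic ψ) s)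
    (hN : ∃ C : ℝ, 0 < C ∧ ∀ n : ℕ, countIntegral z (z n) ((1 - ‖z n‖) / 2) ≤
        ENNReal.ofReal (C * ψ (1 / (1 - ‖z n‖)))) :
    IsSparse z (dyadic ψ) := by
  obtain ⟨B, hB, hN⟩ := hN
  obtain ⟨C, q, hC, hq, -, hr⟩ := hg.exists_ratio
  have hψ : ∀ n, B * ψ (1 / (1 - ‖z n‖)) ≤ B * (C * q) * dyadic ψ (level (z n)) := fun n => by
    have h1 : ψ (1 / (1 - ‖z n‖)) ≤ ψ (2 ^ (level (z n) + 1)) :=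
      hψ_mono (one_le_inv_dist (hz_disc n)) (one_le_pow₀ (by norm_num) : (1 : ℝ) ≤ _)
        lt_pow_level.le
    have h2 := hr 1 (level (z n))
    rw [pow_one, dyadic] at h2
    rw [mul_assoc]
    gcongr
    linarith
  have hpos : ∀ n, 0 < B * (C * q) * dyadic ψ (level (z n)) := fun n => by
    have := hg.one_le (level (z n))
    positivity
  refine ⟨hz_disc, hz_inj, ⟨2 * (B * (C * q)) + 1, by positivity, fun n S hS => ?_⟩,
    ⟨B * (C * q), by positivity, fun n S hS => ?_⟩⟩
  · have hd : 0 < (1 - ‖z n‖) / 4 := by linarith [hz_disc n]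
    have h1 := countDisc_sub_one_le (z := z) (ζ := z n) hd
    rw [show 2 * ((1 - ‖z n‖) / 4) = (1 - ‖z n‖) / 2 by ring] at h1
    have h2 : (S.card : ℝ≥0∞) ≤ countDisc z (z n) ((1 - ‖z n‖) / 4) := by
      have : ((S : Set ℕ)).encard ≤ countDisc z (z n) ((1 - ‖z n‖) / 4) :=
        Set.encard_le_encard fun k hk => hS k hk
      rw [Set.encard_coe_eq_coe_finsetCard] at this
      simpa using ENat.toENNReal_le.2 this
    have h3 : (S.card : ℝ≥0∞) ≤
        ENNReal.ofReal (2 * (B * (C * q)) * dyadic ψ (level (z n)) + 1) := by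
      calc (S.card : ℝ≥0∞) ≤ (countDisc z (z n) ((1 - ‖z n‖) / 4) - 1) + 1 :=
            h2.trans le_tsub_add
        _ ≤ 2 * ENNReal.ofReal (B * (C * q) * dyadic ψ (level (z n))) + 1 := by
            gcongr
            refine h1.trans ?_
            gcongr
            exact (hN n).trans (ENNReal.ofReal_le_ofReal (hψ n))
        _ = _ := by
            rw [mul_assoc 2, ENNReal.ofReal_add (by linarith [hpos n]) zero_le_one,
              ENNReal.ofReal_mul zero_le_two]
            simp
    rw [← ENNReal.ofReal_natCast, ENNReal.ofReal_le_ofReal_iff (by linarith [hpos n])] at h3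
    linarith [hg.one_le (level (z n))]
  · have h1 := ((sum_posLog_le hz_inj n (by linarith [hz_disc n]) S hS).trans (hN n)).trans
      (ENNReal.ofReal_le_ofReal (hψ n))
    rwa [ENNReal.ofReal_le_ofReal_iff (hpos n).le] at h1

end Counting

/-! ### The kernel -/

theorem one_sub_le_norm_one_sub_conj_mul {a w : ℂ} (ha : ‖a‖ ≤ 1) (hw : ‖w‖ ≤ 1) :
    1 - ‖a‖ ≤ ‖1 - conj a * w‖ ∧ 1 - ‖w‖ ≤ ‖1 - conj a * w‖ := by
  have h1 : 1 - ‖a‖ * ‖w‖ ≤ ‖1 - conj a * w‖ := by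
    have := norm_sub_norm_le (1 : ℂ) (conj a * w)
    rwa [norm_one, norm_mul, RCLike.norm_conj] at this
  have h2 := norm_nonneg a
  have h3 := norm_nonneg w
  constructor <;> nlinarith

theorem one_sub_conj_mul_ne_zero {a w : ℂ} (ha : ‖a‖ ≤ 1) (hw : ‖w‖ < 1) :
    1 - conj a * w ≠ 0 := by
  rw [← norm_pos_iff]
  linarith [(one_sub_le_norm_one_sub_conj_mul ha hw.le).2]

theorem norm_kernelA {a : ℂ} (ha : ‖a‖ ≤ 1) (w : ℂ) :
    ‖kernelA a w‖ = (1 - ‖a‖ ^ 2) / ‖1 - conj a * w‖ := by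
  rw [kernelA, norm_div, ← Complex.ofReal_one, ← Complex.ofReal_sub, Complex.norm_real,
    Real.norm_of_nonneg]
  nlinarith [norm_nonneg a]

theorem norm_kernelA_le {a : ℂ} (ha : ‖a‖ < 1) (w : ℂ) :
    ‖kernelA a w‖ ≤ 2 * (1 - ‖a‖) / ‖1 - conj a * w‖ := by
  rw [norm_kernelA ha.le]
  gcongr
  nlinarith [norm_nonneg a]

theorem norm_kernelA_le_two {a w : ℂ} (ha : ‖a‖ < 1) (hw : ‖w‖ < 1) : ‖kernelA a w‖ ≤ 2 := by
  have h := (one_sub_le_norm_one_sub_conj_mul ha.le hw.le).1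
  refine (norm_kernelA_le ha w).trans ?_
  rw [div_le_iff₀ (by linarith)]
  linarith

theorem norm_kernelA_le_div {a w : ℂ} (ha : ‖a‖ < 1) (hw : ‖w‖ < 1) :
    ‖kernelA a w‖ ≤ 2 * (1 - ‖a‖) / (1 - ‖w‖) := by
  refine (norm_kernelA_le ha w).trans ?_
  have h := (one_sub_le_norm_one_sub_conj_mul ha.le hw.le).2
  have h1 : 0 ≤ 1 - ‖a‖ := by linarith
  have h2 : 0 < 1 - ‖w‖ := by linarith
  gcongr

theorem kernelA_self {a : ℂ} (ha : ‖a‖ < 1) : kernelA a a = 1 := by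
  have h : (1 - ((‖a‖ ^ 2 : ℝ) : ℂ)) = 1 - conj a * a := by
    rw [← Complex.normSq_eq_conj_mul_self, Complex.normSq_eq_norm_sq]
  rw [kernelA, h, div_self (one_sub_conj_mul_ne_zero ha.le ha)]

theorem differentiableOn_kernelA {a : ℂ} (ha : ‖a‖ ≤ 1) :
    DifferentiableOn ℂ (kernelA a) (Metric.ball 0 1) := by
  unfold kernelA
  refine DifferentiableOn.div (by fun_prop) (by fun_prop) fun w hw => ?_
  exact one_sub_conj_mul_ne_zero ha (mem_ball_zero_iff.1 hw)

/-! ### Polar cells -/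

theorem abs_le_mul_norm_one_sub_mul_exp {s θ : ℝ} (hs : 0 ≤ s) (hθ : |θ| ≤ Real.pi) :
    |θ| ≤ 8 * ‖(1 : ℂ) - s * Complex.exp (θ * Complex.I)‖ := by
  have h1 : ‖(1 : ℂ) - s * Complex.exp (θ * Complex.I)‖ ^ 2 = 1 - 2 * s * Real.cos θ + s ^ 2 := by
    rw [Complex.sq_norm, Complex.normSq_apply]
    simp only [Complex.sub_re, Complex.one_re, Complex.re_ofReal_mul, Complex.exp_ofReal_mul_I_re,
      Complex.sub_im, Complex.one_im, Complex.im_ofReal_mul, Complex.exp_ofReal_mul_I_im]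
    linear_combination s ^ 2 * Real.sin_sq_add_cos_sq θ
  have h2 := Real.cos_le_one_sub_mul_cos_sq hθ
  have hpi : Real.pi ^ 2 ≤ 16 := by nlinarith [Real.pi_lt_d2, Real.pi_pos]
  have h3 : (1 : ℝ) / 16 * θ ^ 2 ≤ 1 / Real.pi ^ 2 * θ ^ 2 := by gcongr
  have h4 : Real.cos θ ≤ 1 - 1 / 8 * θ ^ 2 := by
    have : 2 / Real.pi ^ 2 * θ ^ 2 = 2 * (1 / Real.pi ^ 2 * θ ^ 2) := by ring
    linarith
  have h5 : θ ^ 2 ≤ 16 := by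
    rw [← sq_abs]
    exact (pow_le_pow_left₀ (abs_nonneg _) hθ 2).trans hpi
  refine abs_le_of_sq_le_sq (?_ : θ ^ 2 ≤ _) (by positivity)
  rw [mul_pow, h1]
  rcases le_total (1 / 2) s with h | h <;> nlinarith [sq_nonneg θ, sq_nonneg (1 - s)]

/-- The polar cell of a point relative to a direction: its dyadic level, its angle at the scale
of the level, its distance to the circle at that scale, and the sign of the angle. -/
def polarCell (u a : ℂ) : ℕ × ℕ × ℕ × Bool :=
  (level a, ⌊16 * 2 ^ level a * |(a * conj u).arg|⌋₊, ⌊16 * 2 ^ level a * (1 - ‖a‖)⌋₊,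
    decide (0 ≤ (a * conj u).arg))

theorem abs_sub_lt_of_floor_eq {c x y : ℝ} (hc : 0 < c) (hx : 0 ≤ x) (hy : 0 ≤ y)
    (h : ⌊c * x⌋₊ = ⌊c * y⌋₊) : |x - y| < 1 / c := by
  have h1 := Nat.floor_le (mul_nonneg hc.le hx)
  have h2 := Nat.floor_le (mul_nonneg hc.le hy)
  have h3 := Nat.lt_floor_add_one (c * x)
  have h4 := Nat.lt_floor_add_one (c * y)
  rw [h] at h1 h3
  have e : |x - y| * c = |(x - y) * c| := by rw [abs_mul, abs_of_pos hc]
  rw [lt_div_iff₀ hc, e, abs_lt]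
  constructor <;> nlinarith

/-- The mesh `1 / (16 * 2 ^ level b)` is below `(1 - ‖b‖) / 8`, and the radial and angular
differences contribute one mesh each. Hence the density bound applies to each cell. -/
theorem norm_sub_le_of_polarCell_eq {u a b : ℂ} (hu : ‖u‖ = 1) (ha : ‖a‖ < 1) (hb : ‖b‖ < 1)
    (h : polarCell u a = polarCell u b) : ‖a - b‖ ≤ (1 - ‖b‖) / 4 := by
  simp only [polarCell, Prod.mk.injEq, decide_eq_decide] at h
  obtain ⟨hL, hang, hrad, hsgn⟩ := h
  rw [hL] at hang hrad
  have hc : (0 : ℝ) < 16 * 2 ^ level b := by positivity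
  have h1 := abs_sub_lt_of_floor_eq hc (by linarith) (by linarith) hrad
  have h2 := abs_sub_lt_of_floor_eq hc (abs_nonneg _) (abs_nonneg _) hang
  set α := (a * conj u).arg
  set β := (b * conj u).arg
  have h3 : |α - β| < 1 / (16 * 2 ^ level b) := by
    rcases le_or_gt 0 β with h0 | h0
    · rwa [abs_of_nonneg h0, abs_of_nonneg (hsgn.2 h0)] at h2
    · rw [abs_of_neg h0, abs_of_neg (not_le.1 fun h' => not_le.2 h0 (hsgn.1 h'))] at h2
      rw [abs_sub_comm]
      rwa [show β - α = -α - -β by ring]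
  have hpa : (‖a‖ : ℂ) * Complex.exp (α * Complex.I) = a * conj u := by
    rw [← Complex.norm_mul_exp_arg_mul_I (a * conj u), norm_mul, RCLike.norm_conj, hu, mul_one]
  have hpb : (‖b‖ : ℂ) * Complex.exp (β * Complex.I) = b * conj u := by
    rw [← Complex.norm_mul_exp_arg_mul_I (b * conj u), norm_mul, RCLike.norm_conj, hu, mul_one]
  have h4 : ‖Complex.exp (α * Complex.I) - Complex.exp (β * Complex.I)‖ ≤ |α - β| := by
    have e : Complex.exp (α * Complex.I) - Complex.exp (β * Complex.I)
        = Complex.exp (β * Complex.I) * (Complex.exp (Complex.I * ((α - β : ℝ) : ℂ)) - 1) := by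
      rw [mul_sub, ← Complex.exp_add]
      push_cast
      ring_nf
    rw [e, norm_mul, Complex.norm_exp_ofReal_mul_I, one_mul]
    exact Real.norm_exp_I_mul_ofReal_sub_one_le
  have h5 : ‖a - b‖ = ‖(a - b) * conj u‖ := by rw [norm_mul, RCLike.norm_conj, hu, mul_one]
  have h6 : ‖a - b‖ ≤ |‖a‖ - ‖b‖| + |α - β| := by
    rw [h5, sub_mul, ← hpa, ← hpb]
    have e : (‖a‖ : ℂ) * Complex.exp (α * Complex.I) - ‖b‖ * Complex.exp (β * Complex.I)
        = ((‖a‖ - ‖b‖ : ℝ) : ℂ) * Complex.exp (α * Complex.I)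
          + ‖b‖ * (Complex.exp (α * Complex.I) - Complex.exp (β * Complex.I)) := by
      push_cast
      ring
    rw [e]
    refine (norm_add_le _ _).trans (add_le_add ?_ ?_)
    · rw [norm_mul, Complex.norm_exp_ofReal_mul_I, mul_one, Complex.norm_real, Real.norm_eq_abs]
    · rw [norm_mul, Complex.norm_real, norm_norm]
      exact (mul_le_of_le_one_left (norm_nonneg _) hb.le).trans h4
  have h7 := lt_dist_mul_pow_level hb
  have h8 : 1 / (16 * 2 ^ level b) < (1 - ‖b‖) / 8 := by
    rw [div_lt_iff₀ hc]
    rw [pow_succ] at h7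
    linarith
  rw [show 1 - ‖a‖ - (1 - ‖b‖) = -(‖a‖ - ‖b‖) by ring, abs_neg] at h1
  linarith

/-- `2 ^ level a * |1 - ā w|` dominates both the gap in levels (factor `2`) and the angular index
(factor `128 = 16 * 8`); the numerator of the kernel doubles their sum to `260`. -/
theorem norm_kernelA_le_polarCell {u a : ℂ} {r : ℝ} (hu : ‖u‖ = 1) (ha : ‖a‖ < 1) (hr : 0 ≤ r)
    (hr1 : r < 1) : ‖kernelA a (r * u)‖ ≤
      260 / (2 ^ (level a - level (r * u)) + (polarCell u a).2.1) := by
  have hnw : ‖(r : ℂ) * u‖ = r := by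
    rw [norm_mul, hu, mul_one, Complex.norm_real, Real.norm_of_nonneg hr]
  have hw : ‖(r : ℂ) * u‖ < 1 := by rwa [hnw]
  obtain ⟨h1, h2⟩ := one_sub_le_norm_one_sub_conj_mul ha.le hw.le
  set x := ‖1 - conj a * (r * u)‖ with hx
  have h3 : |(a * conj u).arg| ≤ 8 * x := by
    have h := abs_le_mul_norm_one_sub_mul_exp (s := r * ‖a‖) (by positivity)
      (Complex.abs_arg_le_pi (a * conj u))
    have e : conj (1 - conj a * (r * u)) =
        1 - ((r * ‖a‖ : ℝ) : ℂ) * Complex.exp ((a * conj u).arg * Complex.I) := by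
      have hpa : (‖a‖ : ℂ) * Complex.exp ((a * conj u).arg * Complex.I) = a * conj u := by
        have := Complex.norm_mul_exp_arg_mul_I (a * conj u)
        rwa [norm_mul, RCLike.norm_conj, hu, mul_one] at this
      push_cast
      rw [mul_assoc, hpa]
      simp
      ring
    rwa [← e, RCLike.norm_conj] at h
  have hp : (0 : ℝ) < 2 ^ level a := by positivity
  have h4 : (2 : ℝ) ^ (level a - level (r * u)) ≤ 2 * (2 ^ level a * x) := by
    rcases le_total (level a) (level (r * u)) with h | h
    · rw [Nat.sub_eq_zero_of_le h, pow_zero]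
      have := lt_dist_mul_pow_level ha
      rw [pow_succ] at this
      nlinarith
    · have h5 := lt_dist_mul_pow_level hw
      have h6 : (2 : ℝ) ^ level a = 2 ^ (level a - level (r * u)) * 2 ^ level (r * u) := by
        rw [← pow_add, Nat.sub_add_cancel h]
      rw [h6, pow_succ] at *
      have h7 : 1 ≤ 2 * (2 ^ level (r * u) * x) := by
        nlinarith [pow_pos (two_pos : (0 : ℝ) < 2) (level (r * u))]
      calc (2 : ℝ) ^ (level a - level (r * u))
          ≤ 2 ^ (level a - level (r * u)) * (2 * (2 ^ level (r * u) * x)) :=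
            le_mul_of_one_le_right (by positivity) h7
        _ = _ := by ring
  have h5 : ((polarCell u a).2.1 : ℝ) ≤ 128 * (2 ^ level a * x) := by
    refine (Nat.floor_le (by positivity)).trans ?_
    nlinarith
  have hx0 : 0 < x := by linarith
  refine (norm_kernelA_le ha _).trans ?_
  rw [← hx, div_le_div_iff₀ hx0 (by positivity)]
  have h6 := dist_mul_pow_level_le ha
  have h7 : 0 < 1 - ‖a‖ := by linarith
  calc 2 * (1 - ‖a‖) * (2 ^ (level a - level (r * u)) + (polarCell u a).2.1)
      ≤ 2 * (1 - ‖a‖) * (130 * (2 ^ level a * x)) := by gcongr; linarith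
    _ = 260 * x * ((1 - ‖a‖) * 2 ^ level a) := by ring
    _ ≤ 260 * x * 1 := by gcongr
    _ = _ := by ring

/-- For exponent `2` the sum telescopes against `2 / (m + l)`; the remaining factors are at most `1
/ m`. -/
theorem sum_inv_pow_le {m : ℝ} (hm : 1 ≤ m) {s : ℕ} (hs : 1 ≤ s) (N : ℕ) :
    ∑ l ∈ Finset.range N, (1 / (m + l)) ^ (s + 1) ≤ 2 / m ^ s := by
  have h1 : ∀ N : ℕ, ∑ l ∈ Finset.range N, (1 / (m + l)) ^ 2 ≤ 2 / m - 2 / (m + N) := fun N => by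
    induction N with
    | zero => simp
    | succ N ih =>
      rw [Finset.sum_range_succ]
      have h2 : (1 / (m + N)) ^ 2 ≤ 2 / (m + N) - 2 / (m + (N + 1 : ℕ)) := by
        have hN : (0 : ℝ) ≤ N := N.cast_nonneg
        push_cast
        rw [div_sub_div _ _ (by positivity) (by positivity), div_pow,
          div_le_div_iff₀ (by positivity) (by positivity)]
        nlinarith [sq_nonneg (m + N), mul_nonneg (sq_nonneg (m + N)) hN]
      linarith
  obtain ⟨t, rfl⟩ : ∃ t, s = t + 1 := ⟨s - 1, by omega⟩
  calc ∑ l ∈ Finset.range N, (1 / (m + l)) ^ (t + 1 + 1)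
      ≤ ∑ l ∈ Finset.range N, (1 / m) ^ t * (1 / (m + l)) ^ 2 := by
        refine Finset.sum_le_sum fun l _ => ?_
        rw [add_assoc, pow_add]
        gcongr
        have : (0 : ℝ) ≤ l := l.cast_nonneg
        linarith
    _ = (1 / m) ^ t * ∑ l ∈ Finset.range N, (1 / (m + l)) ^ 2 := by rw [Finset.mul_sum]
    _ ≤ (1 / m) ^ t * (2 / m) := by
        gcongr
        have : 0 ≤ 2 / (m + N) := by positivity
        linarith [h1 N]
    _ = _ := by rw [one_div, inv_pow, pow_succ]; field_simp

/-- For each level `j` and angular index `l` there are `17 * 2 = 34` cells, each with at most `K * φ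
j` points. Summing over `l` loses one power of `2 ^ (j - J)`, which is why the exponent is `s + 1`
and the damping `s`. -/
theorem exists_sum_kernelA_le {z : ℕ → ℂ} {φ : ℕ → ℝ} {s : ℕ} (hz : IsSparse z φ)
    (hφ : IsGrowth φ s) (hs : 1 ≤ s) :
    ∃ C : ℝ, 0 < C ∧ ∀ w : ℂ, ‖w‖ < 1 → ∀ S : Finset ℕ,
      ∑ n ∈ S, ‖kernelA (z n) w‖ ^ (s + 1) ≤ C * partialSum φ (level w) := by
  obtain ⟨K, hK, hcard⟩ := hz.exists_card_le
  obtain ⟨B, hB, hsum⟩ := exists_sum_damped_le hφ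
  refine ⟨68 * K * 260 ^ (s + 1) * B, by positivity, fun w hw S => ?_⟩
  obtain ⟨u, hu, hwu⟩ : ∃ u : ℂ, ‖u‖ = 1 ∧ w = (‖w‖ : ℂ) * u :=
    ⟨Complex.exp (w.arg * Complex.I), Complex.norm_exp_ofReal_mul_I _,
      (Complex.norm_mul_exp_arg_mul_I w).symm⟩
  set J := level w with hJ
  set g : ℕ × ℕ × ℕ × Bool → ℝ := fun c => (260 / ((2 : ℝ) ^ (c.1 - J) + c.2.1)) ^ (s + 1) with hg
  have hg0 : ∀ c, 0 ≤ g c := fun c => by positivity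
  have hle : ∀ n, ‖kernelA (z n) w‖ ^ (s + 1) ≤ g (polarCell u (z n)) := fun n => by
    have h := norm_kernelA_le_polarCell hu (hz.norm_lt_one n) (norm_nonneg w) hw
    rw [← hwu] at h
    exact pow_le_pow_left₀ (norm_nonneg _) h _
  obtain ⟨N, hN⟩ : ∃ N, ∀ n ∈ S, level (z n) < N ∧ (polarCell u (z n)).2.1 < N :=
    ⟨∑ n ∈ S, (level (z n) + (polarCell u (z n)).2.1) + 1, fun n hn => by
      have := Finset.single_le_sum
        (f := fun n => level (z n) + (polarCell u (z n)).2.1) (fun _ _ => Nat.zero_le _) hn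
      omega⟩
  set T : Finset (ℕ × ℕ × ℕ × Bool) :=
    Finset.range N ×ˢ Finset.range N ×ˢ Finset.range 17 ×ˢ Finset.univ with hT
  have hmaps : ∀ n ∈ S, polarCell u (z n) ∈ T := fun n hn => by
    simp only [hT, Finset.mem_product, Finset.mem_range, Finset.mem_univ, and_true]
    refine ⟨(hN n hn).1, (hN n hn).2, ?_⟩
    have h : 16 * 2 ^ level (z n) * (1 - ‖z n‖) < ((17 : ℕ) : ℝ) := by
      have := dist_mul_pow_level_le (hz.norm_lt_one n)
      push_cast
      linarith
    exact (Nat.floor_lt' (by norm_num)).2 h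
  calc ∑ n ∈ S, ‖kernelA (z n) w‖ ^ (s + 1) ≤ ∑ n ∈ S, g (polarCell u (z n)) :=
        Finset.sum_le_sum fun n _ => hle n
    _ = ∑ c ∈ T, ∑ n ∈ S with polarCell u (z n) = c, g (polarCell u (z n)) :=
        (Finset.sum_fiberwise_of_maps_to hmaps _).symm
    _ ≤ ∑ c ∈ T, K * φ c.1 * g c := by
        refine Finset.sum_le_sum fun c _ => ?_
        have h1 : ∑ n ∈ S with polarCell u (z n) = c, g (polarCell u (z n))
            = (S.filter fun n => polarCell u (z n) = c).card * g c := by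
          rw [← nsmul_eq_mul, ← Finset.sum_const]
          exact Finset.sum_congr rfl fun n hn => by rw [(Finset.mem_filter.1 hn).2]
        rw [h1]
        refine mul_le_mul_of_nonneg_right ?_ (hg0 c)
        rcases (S.filter fun n => polarCell u (z n) = c).eq_empty_or_nonempty with he | ⟨n, hn⟩
        · rw [he]
          have := hφ.one_le c.1
          simp
          positivity
        · have hn2 := (Finset.mem_filter.1 hn).2
          have h2 := hcard n (S.filter fun n => polarCell u (z n) = c) fun k hk =>
            norm_sub_le_of_polarCell_eq hu (hz.norm_lt_one k) (hz.norm_lt_one n)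
              ((Finset.mem_filter.1 hk).2.trans hn2.symm)
          rwa [show level (z n) = c.1 by rw [← hn2]; rfl] at h2
    _ = ∑ j ∈ Finset.range N, 34 * K * 260 ^ (s + 1) * φ j *
          ∑ l ∈ Finset.range N, (1 / ((2 : ℝ) ^ (j - J) + l)) ^ (s + 1) := by
        rw [hT, Finset.sum_product]
        refine Finset.sum_congr rfl fun j _ => ?_
        rw [Finset.sum_product, Finset.mul_sum]
        refine Finset.sum_congr rfl fun l _ => ?_
        simp only [hg, Finset.sum_const, Finset.card_product, Finset.card_range,
          Finset.card_univ, Fintype.card_bool, nsmul_eq_mul]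
        rw [div_eq_mul_one_div (260 : ℝ), mul_pow]
        push_cast
        ring
    _ ≤ ∑ j ∈ Finset.range N, 34 * K * 260 ^ (s + 1) * φ j * (2 / ((2 : ℝ) ^ (j - J)) ^ s) := by
        refine Finset.sum_le_sum fun j _ => ?_
        have := hφ.one_le j
        gcongr
        exact sum_inv_pow_le (one_le_pow₀ (by norm_num)) hs N
    _ = 68 * K * 260 ^ (s + 1) * ∑ j ∈ Finset.range N, φ j / ((2 : ℝ) ^ (j - J)) ^ s := by
        rw [Finset.mul_sum]
        exact Finset.sum_congr rfl fun j _ => by ring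
    _ ≤ 68 * K * 260 ^ (s + 1) * (B * partialSum φ J) := by
        gcongr
        exact hsum J N
    _ = _ := by ring

/-! ### Primary factors -/

/-- The exponent is the Taylor remainder of `log (1 - w)` after `s` terms. -/
theorem exists_primaryFactor_eq_exp {s : ℕ} (hs : 1 ≤ s) {w : ℂ} (hw : ‖w‖ ≤ 1 / 2) :
    ∃ v : ℂ, primaryFactor s w = Complex.exp v ∧ ‖v‖ ≤ ‖w‖ ^ (s + 1) := by
  have hw1 : ‖w‖ < 1 := by linarith
  have h1w : (1 : ℂ) - w ≠ 0 := by
    rw [sub_ne_zero]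
    rintro rfl
    norm_num at hw
  refine ⟨Complex.log (1 - w) + ∑ j ∈ Finset.Icc 1 s, w ^ j / (j : ℂ), ?_, ?_⟩
  · rw [Complex.exp_add, Complex.exp_log h1w, primaryFactor]
  · have h := Complex.norm_log_sub_logTaylor_le s (z := -w) (by rwa [norm_neg])
    have e : Complex.logTaylor (s + 1) (-w) = -∑ j ∈ Finset.Icc 1 s, w ^ j / (j : ℂ) := by
      rw [Complex.logTaylor, ← Finset.sum_neg_distrib, Finset.range_eq_Ico,
        Finset.sum_eq_sum_Ico_succ_bot (by omega)]
      simp only [Nat.cast_zero, div_zero, zero_add]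
      refine Finset.sum_congr (by ext; simp) fun j _ => ?_
      rw [neg_pow w j, pow_succ]
      have : ((-1 : ℂ) ^ j) * (-1) ^ j = 1 := by rw [← mul_pow]; simp
      linear_combination (-w ^ j / j) * this
    rw [e, sub_neg_eq_add, ← sub_eq_add_neg, norm_neg] at h
    refine h.trans ?_
    rw [mul_div_assoc]
    refine mul_le_of_le_one_right (by positivity) ?_
    have h2 : (1 - ‖w‖)⁻¹ ≤ 2 := by
      rw [inv_le_comm₀ (by linarith) (by norm_num)]
      linarith
    have h3 : (1 : ℝ) ≤ s := by exact_mod_cast hs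
    rw [div_le_one (by positivity)]
    linarith

theorem norm_sum_pow_div_le {s : ℕ} {w : ℂ} (hw : ‖w‖ ≤ 2) :
    ‖∑ j ∈ Finset.Icc 1 s, w ^ j / (j : ℂ)‖ ≤ ∑ j ∈ Finset.Icc 1 s, (2 : ℝ) ^ j := by
  refine norm_sum_le_of_le _ fun j hj => ?_
  have hj1 : (1 : ℝ) ≤ j := by exact_mod_cast (Finset.mem_Icc.1 hj).1
  rw [norm_div, norm_pow, Complex.norm_natCast]
  exact (div_le_self (by positivity) hj1).trans (pow_le_pow_left₀ (norm_nonneg _) hw _)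

theorem exists_norm_primaryFactor_sub_one_le {s : ℕ} (hs : 1 ≤ s) :
    ∃ C : ℝ, 0 < C ∧ ∀ w : ℂ, ‖w‖ ≤ 2 → ‖primaryFactor s w - 1‖ ≤ C * ‖w‖ ^ (s + 1) := by
  set M : ℝ := ∑ j ∈ Finset.Icc 1 s, (2 : ℝ) ^ j
  refine ⟨2 + (3 * Real.exp M + 1) * 2 ^ (s + 1), by positivity, fun w hw => ?_⟩
  rcases le_total ‖w‖ (1 / 2) with h | h
  · obtain ⟨v, hv, hvw⟩ := exists_primaryFactor_eq_exp hs h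
    have h1 : ‖v‖ ≤ 1 := hvw.trans (pow_le_one₀ (norm_nonneg _) (by linarith))
    rw [hv]
    refine (Complex.norm_exp_sub_one_le h1).trans ?_
    have : 0 ≤ (3 * Real.exp M + 1) * 2 ^ (s + 1) * ‖w‖ ^ (s + 1) := by positivity
    linarith
  -- Away from `0` a constant bound is enough, since `(2 ‖w‖) ^ (s + 1) ≥ 1`.
  · have h1 : ‖primaryFactor s w‖ ≤ 3 * Real.exp M := by
      rw [primaryFactor, norm_mul]
      gcongr
      · refine (norm_sub_le _ _).trans ?_
        rw [norm_one]
        linarith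
      · exact (Complex.norm_exp_le_exp_norm _).trans (Real.exp_le_exp.2 (norm_sum_pow_div_le hw))
    have h2 : 1 ≤ 2 ^ (s + 1) * ‖w‖ ^ (s + 1) := by
      rw [← mul_pow]
      exact one_le_pow₀ (by linarith)
    calc ‖primaryFactor s w - 1‖ ≤ 3 * Real.exp M + 1 := by
          refine (norm_sub_le _ _).trans ?_
          rw [norm_one]
          linarith
      _ ≤ (3 * Real.exp M + 1) * (2 ^ (s + 1) * ‖w‖ ^ (s + 1)) :=
          le_mul_of_one_le_right (by positivity) h2
      _ ≤ _ := by
          have : 0 ≤ ‖w‖ ^ (s + 1) := by positivity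
          linarith

theorem exp_neg_mul_le_norm_exp {M : ℝ} {v : ℂ} (hv : ‖v‖ ≤ M) :
    Real.exp (-M) ≤ ‖Complex.exp v‖ := by
  rw [Complex.norm_exp, Real.exp_le_exp]
  linarith [(abs_le.1 ((Complex.abs_re_le_norm v).trans hv)).1]

/-! ### Canonical factors -/

theorem kernelA_zero (w : ℂ) : kernelA 0 w = 1 := by simp [kernelA]

theorem one_sub_kernelA {a w : ℂ} (h : 1 - conj a * w ≠ 0) :
    1 - kernelA a w = conj a * (a - w) / (1 - conj a * w) := by
  have h1 : ((‖a‖ ^ 2 : ℝ) : ℂ) = conj a * a := by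
    rw [← Complex.normSq_eq_conj_mul_self, Complex.normSq_eq_norm_sq]
  rw [kernelA, h1]
  field_simp
  ring

theorem exists_norm_canonicalFactor_sub_one_le {s : ℕ} (hs : 1 ≤ s) :
    ∃ C : ℝ, 0 < C ∧ ∀ a w : ℂ, ‖a‖ < 1 → ‖w‖ < 1 →
      ‖canonicalFactor s a w - 1‖ ≤ C * ‖kernelA a w‖ ^ (s + 1) := by
  obtain ⟨C, hC, h⟩ := exists_norm_primaryFactor_sub_one_le hs
  refine ⟨C + 2, by positivity, fun a w ha hw => ?_⟩
  rw [canonicalFactor]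
  split_ifs with h0
  · rw [h0, kernelA_zero, norm_one, one_pow, mul_one]
    refine (norm_sub_le _ _).trans ?_
    rw [norm_one]
    linarith
  · refine (h _ (norm_kernelA_le_two ha hw)).trans ?_
    gcongr
    linarith

/-- For small kernel values the factor is an exponential of a small number. Otherwise it is small
only through `1 - A = ā (a - w) / (1 - ā w)`, that is, for `w` near `a`, which the `log⁺` term
measures; `c` keeps `ā`, or the factor `w` when `a = 0`, away from zero. -/
theorem exists_le_norm_canonicalFactor {s : ℕ} (hs : 1 ≤ s) {c : ℝ} (hc : 0 < c) (hc1 : c ≤ 1) :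
    ∃ C : ℝ, 0 < C ∧ ∀ a w : ℂ, ‖a‖ < 1 → ‖w‖ < 1 → a ≠ w → (a = 0 → c ≤ ‖w‖) →
      (a ≠ 0 → c ≤ ‖a‖) →
      Real.exp (-(C * ‖kernelA a w‖ ^ (s + 1) + Real.posLog ((1 - ‖w‖) / 2 / ‖a - w‖)))
        ≤ ‖canonicalFactor s a w‖ := by
  set M : ℝ := ∑ j ∈ Finset.Icc 1 s, (2 : ℝ) ^ j with hM
  have hM0 : 0 ≤ M := Finset.sum_nonneg fun _ _ => by positivity
  have hlog : 0 ≤ Real.log (5 / c) := Real.log_nonneg (by rw [le_div_iff₀ hc]; linarith)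
  set K : ℝ := M + Real.log (5 / c) with hK
  have hK0 : 0 ≤ K := by positivity
  refine ⟨1 + 2 ^ (s + 1) * K, by positivity, fun a w ha hw hne h0 h1 => ?_⟩
  set p : ℝ := Real.posLog ((1 - ‖w‖) / 2 / ‖a - w‖) with hp
  have hp0 : 0 ≤ p := Real.posLog_nonneg
  have hlogc : Real.exp (-Real.log (5 / c)) = c / 5 := by
    rw [Real.exp_neg, Real.exp_log (by positivity), inv_div]
  have h2s : (1 : ℝ) ≤ 2 ^ (s + 1) := one_le_pow₀ (by norm_num)
  rw [canonicalFactor]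
  split_ifs with ha0
  · calc Real.exp (-((1 + 2 ^ (s + 1) * K) * ‖kernelA a w‖ ^ (s + 1) + p))
        ≤ Real.exp (-Real.log (5 / c)) := by
          rw [Real.exp_le_exp, ha0, kernelA_zero, norm_one, one_pow]
          nlinarith
      _ = c / 5 := hlogc
      _ ≤ ‖w‖ := by linarith [h0 ha0]
  · set A := kernelA a w with hA
    rcases le_or_gt ‖A‖ (1 / 2) with h | h
    · obtain ⟨v, hv, hvA⟩ := exists_primaryFactor_eq_exp hs h
      rw [hv]
      refine le_trans (Real.exp_le_exp.2 ?_) (exp_neg_mul_le_norm_exp hvA)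
      have : 0 ≤ 2 ^ (s + 1) * K * ‖A‖ ^ (s + 1) := by positivity
      linarith
    · have hA2 : ‖A‖ ≤ 2 := norm_kernelA_le_two ha hw
      have hden := one_sub_conj_mul_ne_zero ha.le hw
      have ht : 0 < ‖a - w‖ := norm_pos_iff.2 (sub_ne_zero.2 hne)
      have hexp : (1 - ‖w‖) / 2 ≤ ‖a - w‖ * Real.exp p ∧ 1 ≤ Real.exp p := by
        refine ⟨?_, Real.one_le_exp hp0⟩
        have hR : 0 < (1 - ‖w‖) / 2 / ‖a - w‖ := div_pos (by linarith) ht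
        have : (1 - ‖w‖) / 2 / ‖a - w‖ ≤ Real.exp p := by
          rw [← Real.log_le_iff_le_exp hR, hp, Real.posLog]
          exact le_max_right _ _
        rwa [div_le_iff₀ ht, mul_comm] at this
      -- From `|1 - ā w| ≤ 2 (1 - |w|) + |a - w|`: the first term is at most `4 |a - w| exp p`, the
      -- second at most `|a - w| exp p`.
      have hupper : ‖1 - conj a * w‖ ≤ 5 * (‖a - w‖ * Real.exp p) := by
        have e : 1 - conj a * w = ((1 - ‖w‖ ^ 2 : ℝ) : ℂ) - conj (a - w) * w := by
          have hww : ((‖w‖ ^ 2 : ℝ) : ℂ) = conj w * w := by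
            rw [← Complex.normSq_eq_conj_mul_self, Complex.normSq_eq_norm_sq]
          rw [Complex.ofReal_sub, hww, map_sub]
          push_cast
          ring
        have h3 : ‖((1 - ‖w‖ ^ 2 : ℝ) : ℂ)‖ ≤ 2 * (1 - ‖w‖) := by
          rw [Complex.norm_real, Real.norm_of_nonneg] <;> nlinarith [norm_nonneg w]
        have h4 : ‖conj (a - w) * w‖ ≤ ‖a - w‖ := by
          rw [norm_mul, RCLike.norm_conj]
          exact mul_le_of_le_one_right ht.le hw.le
        have h5 : ‖a - w‖ ≤ ‖a - w‖ * Real.exp p := le_mul_of_one_le_right ht.le hexp.2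
        rw [e]
        linarith [norm_sub_le ((1 - ‖w‖ ^ 2 : ℝ) : ℂ) (conj (a - w) * w), hexp.1]
      have h1A : c / 5 * Real.exp (-p) ≤ ‖1 - A‖ := by
        rw [hA, one_sub_kernelA hden, norm_div, norm_mul, RCLike.norm_conj,
          le_div_iff₀ (norm_pos_iff.2 hden), Real.exp_neg]
        calc c / 5 * (Real.exp p)⁻¹ * ‖1 - conj a * w‖
            ≤ c / 5 * (Real.exp p)⁻¹ * (5 * (‖a - w‖ * Real.exp p)) := by gcongr
          _ = c * ‖a - w‖ := by field_simp
          _ ≤ ‖a‖ * ‖a - w‖ := by gcongr; exact h1 ha0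
      have hpow : 1 ≤ 2 ^ (s + 1) * ‖A‖ ^ (s + 1) := by
        rw [← mul_pow]
        exact one_le_pow₀ (by linarith)
      calc Real.exp (-((1 + 2 ^ (s + 1) * K) * ‖A‖ ^ (s + 1) + p))
          ≤ Real.exp (-Real.log (5 / c) + -p + -M) := by
            rw [Real.exp_le_exp]
            have : 0 ≤ ‖A‖ ^ (s + 1) := by positivity
            nlinarith
        _ = c / 5 * Real.exp (-p) * Real.exp (-M) := by rw [Real.exp_add, Real.exp_add, hlogc]
        _ ≤ ‖1 - A‖ * ‖Complex.exp (∑ j ∈ Finset.Icc 1 s, A ^ j / (j : ℂ))‖ := by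
            gcongr
            exact exp_neg_mul_le_norm_exp (norm_sum_pow_div_le hA2)
        _ = ‖primaryFactor s A‖ := by rw [primaryFactor, norm_mul]

theorem canonicalFactor_ne_zero {s : ℕ} {a w : ℂ} (ha : ‖a‖ < 1) (hw : ‖w‖ < 1) (h : w ≠ a) :
    canonicalFactor s a w ≠ 0 := by
  have hden := one_sub_conj_mul_ne_zero ha.le hw
  rw [canonicalFactor]
  split_ifs with h0
  · rwa [← h0]
  · rw [primaryFactor, one_sub_kernelA hden]
    refine mul_ne_zero (div_ne_zero (mul_ne_zero ?_ (sub_ne_zero.2 h.symm)) hden)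
      (Complex.exp_ne_zero _)
    exact (map_ne_zero _).2 h0

theorem differentiableOn_canonicalFactor (s : ℕ) {a : ℂ} (ha : ‖a‖ ≤ 1) :
    DifferentiableOn ℂ (canonicalFactor s a) (Metric.ball 0 1) := by
  have hA := differentiableOn_kernelA ha
  unfold canonicalFactor primaryFactor
  split_ifs
  · exact differentiableOn_id
  · fun_prop

open Classical in
/-- The cofactor of `w - a` in the canonical factor at `a`. -/
def canonicalCofactor (s : ℕ) (a w : ℂ) : ℂ :=
  if a = 0 then 1 else
    -conj a / (1 - conj a * w) * Complex.exp (∑ j ∈ Finset.Icc 1 s, kernelA a w ^ j / (j : ℂ))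

theorem canonicalFactor_eq_mul {s : ℕ} {a w : ℂ} (ha : ‖a‖ < 1) (hw : ‖w‖ < 1) :
    canonicalFactor s a w = (w - a) * canonicalCofactor s a w := by
  have hden := one_sub_conj_mul_ne_zero ha.le hw
  rw [canonicalFactor, canonicalCofactor]
  split_ifs with h0
  · simp [h0]
  · rw [primaryFactor, one_sub_kernelA hden]
    ring

theorem differentiableOn_canonicalCofactor (s : ℕ) {a : ℂ} (ha : ‖a‖ ≤ 1) :
    DifferentiableOn ℂ (canonicalCofactor s a) (Metric.ball 0 1) := by
  have hA := differentiableOn_kernelA ha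
  unfold canonicalCofactor
  split_ifs
  · exact differentiableOn_const _
  · refine DifferentiableOn.mul (DifferentiableOn.div (by fun_prop) (by fun_prop) fun w hw => ?_)
      (by fun_prop)
    exact one_sub_conj_mul_ne_zero ha (mem_ball_zero_iff.1 hw)

theorem le_norm_canonicalCofactor {s : ℕ} {a : ℂ} {c : ℝ} (ha : ‖a‖ < 1) (hc1 : c ≤ 1)
    (h : a ≠ 0 → c ≤ ‖a‖) : c ≤ ‖canonicalCofactor s a a‖ := by
  rw [canonicalCofactor]
  split_ifs with h0
  · simpa using hc1
  · have hexp : 1 ≤ ‖Complex.exp (∑ j ∈ Finset.Icc 1 s, kernelA a a ^ j / (j : ℂ))‖ := by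
      rw [kernelA_self ha, Complex.norm_exp]
      refine Real.one_le_exp ?_
      rw [Complex.re_sum]
      refine Finset.sum_nonneg fun j _ => ?_
      rw [one_pow, ← Complex.ofReal_natCast, ← Complex.ofReal_one, ← Complex.ofReal_div,
        Complex.ofReal_re]
      positivity
    have hden : ‖1 - conj a * a‖ ≤ 1 := by
      rw [← Complex.normSq_eq_conj_mul_self, Complex.normSq_eq_norm_sq, ← Complex.ofReal_one,
        ← Complex.ofReal_sub, Complex.norm_real, Real.norm_of_nonneg] <;>
      nlinarith [norm_nonneg a]
    have hpos : 0 < ‖1 - conj a * a‖ := norm_pos_iff.2 (one_sub_conj_mul_ne_zero ha.le ha)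
    rw [norm_mul, norm_div, norm_neg, RCLike.norm_conj]
    calc c ≤ ‖a‖ := h h0
      _ ≤ ‖a‖ / ‖1 - conj a * a‖ := le_div_self (norm_nonneg _) hpos hden
      _ ≤ _ := le_mul_of_one_le_right (by positivity) hexp

/-! ### Canonical products -/

theorem norm_tprod_le_exp {f : ℕ → ℂ} {B : ℝ} (hf : Multipliable f)
    (h : ∀ S : Finset ℕ, ∑ k ∈ S, ‖f k - 1‖ ≤ B) : ‖∏' k, f k‖ ≤ Real.exp B := by
  refine le_of_tendsto hf.hasProd.norm (Eventually.of_forall fun S => ?_)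
  simp only [← norm_prod]
  have h1 := Finset.norm_prod_one_add_sub_one_le S fun k => f k - 1
  simp only [add_sub_cancel] at h1
  have h2 := norm_sub_norm_le (∏ k ∈ S, f k) 1
  rw [norm_one] at h2
  have h3 := Real.exp_le_exp.2 (h S)
  linarith

theorem exp_neg_le_norm_tprod {f : ℕ → ℂ} {B : ℝ} {b : ℕ → ℝ} (hf : Multipliable f)
    (hb : ∀ k, Real.exp (-b k) ≤ ‖f k‖) (h : ∀ S : Finset ℕ, ∑ k ∈ S, b k ≤ B) :
    Real.exp (-B) ≤ ‖∏' k, f k‖ := by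
  refine ge_of_tendsto hf.hasProd.norm (Eventually.of_forall fun S => ?_)
  simp only [← norm_prod]
  calc Real.exp (-B) ≤ Real.exp (∑ k ∈ S, -b k) := by
        rw [Real.exp_le_exp, Finset.sum_neg_distrib]
        linarith [h S]
    _ = ∏ k ∈ S, Real.exp (-b k) := Real.exp_sum _ _
    _ ≤ ∏ k ∈ S, ‖f k‖ := Finset.prod_le_prod (fun _ _ => (Real.exp_pos _).le) fun k _ => hb k
    _ = ‖∏ k ∈ S, f k‖ := (norm_prod _ _).symm

section Product

variable {z : ℕ → ℂ} {φ : ℕ → ℝ} {s : ℕ}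

/-- The kernel estimate at `w = 0`, where `|A_n(0)| = 1 - |z_n| ^ 2`. -/
theorem summable_dist_pow (hz : IsSparse z φ) (hφ : IsGrowth φ s) (hs : 1 ≤ s) :
    Summable fun n => (1 - ‖z n‖) ^ (s + 1) := by
  obtain ⟨C, hC, h⟩ := exists_sum_kernelA_le hz hφ hs
  refine summable_of_sum_le (c := C * partialSum φ (level 0)) (fun n => ?_) fun S => ?_
  · have := hz.norm_lt_one n
    exact pow_nonneg (by linarith) _
  · refine le_trans (Finset.sum_le_sum fun n _ => ?_) (h 0 (by simp) S)
    have h1 := hz.norm_lt_one n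
    rw [norm_kernelA h1.le]
    simp only [mul_zero, sub_zero, norm_one, div_one]
    refine pow_le_pow_left₀ (by linarith) ?_ _
    nlinarith [norm_nonneg (z n)]

/-- By summability only finitely many points have modulus at most `1/2`. -/
theorem exists_le_norm (hz : IsSparse z φ) (hφ : IsGrowth φ s) (hs : 1 ≤ s) :
    ∃ c : ℝ, 0 < c ∧ c ≤ 1 ∧ ∀ n, z n ≠ 0 → c ≤ ‖z n‖ := by
  have h1 : ∀ᶠ n in cofinite, (1 - ‖z n‖) ^ (s + 1) < (1 / 2) ^ (s + 1) :=
    (summable_dist_pow hz hφ hs).tendsto_cofinite_zero.eventually_lt_const (by positivity)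
  have hfin : {n | ¬ (1 - ‖z n‖) ^ (s + 1) < (1 / 2) ^ (s + 1)}.Finite :=
    eventually_cofinite.1 h1
  have h2 : ∀ᶠ c : ℝ in 𝓝[>] 0, ∀ n ∈ {n | ¬ (1 - ‖z n‖) ^ (s + 1) < (1 / 2) ^ (s + 1)},
      z n ≠ 0 → c ≤ ‖z n‖ := by
    rw [eventually_all_finite hfin]
    intro n _
    by_cases h0 : z n = 0
    · simp [h0]
    · filter_upwards [nhdsWithin_le_nhds (eventually_le_nhds (norm_pos_iff.2 h0))] with c hc _
      exact hc
  have h3 : ∀ᶠ c : ℝ in 𝓝[>] 0, c ≤ 1 / 2 :=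
    nhdsWithin_le_nhds (eventually_le_nhds (by norm_num))
  obtain ⟨c, hc, hc2, hc0⟩ := (h2.and (h3.and self_mem_nhdsWithin)).exists
  refine ⟨c, hc0, by linarith, fun n hn => ?_⟩
  by_cases h : (1 - ‖z n‖) ^ (s + 1) < (1 / 2) ^ (s + 1)
  · have := lt_of_pow_lt_pow_left₀ _ (by norm_num) h
    linarith
  · exact hc n h hn

theorem hasProdLocallyUniformlyOn_of_kernelA (hz : IsSparse z φ) (hφ : IsGrowth φ s) (hs : 1 ≤ s)
    {f : ℕ → ℂ → ℂ} {C : ℝ} (hC : 0 ≤ C)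
    (hf : ∀ k w, ‖w‖ < 1 → ‖f k w - 1‖ ≤ C * ‖kernelA (z k) w‖ ^ (s + 1))
    (hd : ∀ k, DifferentiableOn ℂ (f k) (Metric.ball 0 1)) :
    HasProdLocallyUniformlyOn f (fun w => ∏' k, f k w) (Metric.ball 0 1) := by
  refine hasProdLocallyUniformlyOn_of_forall_compact Metric.isOpen_ball fun K hK hKc => ?_
  obtain ⟨r, hr0, hr1, hKr⟩ : ∃ r : ℝ, 0 ≤ r ∧ r < 1 ∧ ∀ w ∈ K, ‖w‖ ≤ r := by
    rcases K.eq_empty_or_nonempty with rfl | hne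
    · exact ⟨0, le_rfl, one_pos, by simp⟩
    · obtain ⟨v, hv, hmax⟩ := hKc.exists_isMaxOn hne continuous_norm.continuousOn
      exact ⟨‖v‖, norm_nonneg _, mem_ball_zero_iff.1 (hK hv), fun w hw => hmax hw⟩
  have h := Summable.hasProdUniformlyOn_nat_one_add (f := fun k w => f k w - 1) hKc
    ((summable_dist_pow hz hφ hs).mul_left (C * (2 / (1 - r)) ^ (s + 1)))
    (Eventually.of_forall fun k w hw => ?_)
    fun k => ((hd k).continuousOn.mono hK).sub continuousOn_const
  · simpa only [add_sub_cancel] using h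
  · have hw1 : ‖w‖ < 1 := mem_ball_zero_iff.1 (hK hw)
    have hk := hz.norm_lt_one k
    refine (hf k w hw1).trans ?_
    rw [mul_assoc, ← mul_pow]
    gcongr
    refine (norm_kernelA_le_div hk hw1).trans ?_
    rw [div_mul_eq_mul_div]
    have h1 : 0 ≤ 1 - ‖z k‖ := by linarith
    have h2 : 0 < 1 - r := by linarith
    have h3 := hKr w hw
    gcongr

theorem _root_.HasProdLocallyUniformlyOn.differentiableOn_of_forall {f : ℕ → ℂ → ℂ} {g : ℂ → ℂ}
    {U : Set ℂ} (h : HasProdLocallyUniformlyOn f g U) (hf : ∀ k, DifferentiableOn ℂ (f k) U)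
    (hU : IsOpen U) : DifferentiableOn ℂ g U :=
  (hasProdLocallyUniformlyOn_iff_tendstoLocallyUniformlyOn.1 h).differentiableOn
    (Eventually.of_forall fun _ => DifferentiableOn.fun_finsetProd fun k _ => hf k) hU

theorem hasProdLocallyUniformlyOn_canonicalProduct (hz : IsSparse z φ) (hφ : IsGrowth φ s)
    (hs : 1 ≤ s) :
    HasProdLocallyUniformlyOn (fun n w => canonicalFactor s (z n) w) (canonicalProduct z s)
      (Metric.ball 0 1) := by
  obtain ⟨C, hC, h⟩ := exists_norm_canonicalFactor_sub_one_le hs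
  exact hasProdLocallyUniformlyOn_of_kernelA hz hφ hs hC.le
    (fun k w hw => h _ _ (hz.norm_lt_one k) hw)
    fun k => differentiableOn_canonicalFactor s (hz.norm_lt_one k).le

theorem differentiableOn_canonicalProduct (hz : IsSparse z φ) (hφ : IsGrowth φ s) (hs : 1 ≤ s) :
    DifferentiableOn ℂ (canonicalProduct z s) (Metric.ball 0 1) :=
  (hasProdLocallyUniformlyOn_canonicalProduct hz hφ hs).differentiableOn_of_forall
    (fun k => differentiableOn_canonicalFactor s (hz.norm_lt_one k).le) Metric.isOpen_ball

theorem exists_norm_canonicalProduct_le (hz : IsSparse z φ) (hφ : IsGrowth φ s) (hs : 1 ≤ s) :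
    ∃ C : ℝ, 0 < C ∧ ∀ w : ℂ, ‖w‖ < 1 →
      ‖canonicalProduct z s w‖ ≤ Real.exp (C * partialSum φ (level w)) := by
  obtain ⟨B, hB, hsum⟩ := exists_sum_kernelA_le hz hφ hs
  obtain ⟨C, hC, h⟩ := exists_norm_canonicalFactor_sub_one_le hs
  refine ⟨C * B, by positivity, fun w hw => ?_⟩
  have hp := (hasProdLocallyUniformlyOn_canonicalProduct hz hφ hs).hasProd
    (mem_ball_zero_iff.2 hw)
  refine norm_tprod_le_exp hp.multipliable fun S => ?_
  calc ∑ k ∈ S, ‖canonicalFactor s (z k) w - 1‖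
      ≤ ∑ k ∈ S, C * ‖kernelA (z k) w‖ ^ (s + 1) :=
        Finset.sum_le_sum fun k _ => h _ _ (hz.norm_lt_one k) hw
    _ = C * ∑ k ∈ S, ‖kernelA (z k) w‖ ^ (s + 1) := by rw [Finset.mul_sum]
    _ ≤ C * (B * partialSum φ (level w)) := by gcongr; exact hsum w hw S
    _ = _ := by ring

theorem canonicalProduct_ne_zero (hz : IsSparse z φ) (hφ : IsGrowth φ s) (hs : 1 ≤ s) {w : ℂ}
    (hw : ‖w‖ < 1) (h : ∀ n, w ≠ z n) : canonicalProduct z s w ≠ 0 := by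
  obtain ⟨B, hB, hsum⟩ := exists_sum_kernelA_le hz hφ hs
  obtain ⟨C, hC, hF⟩ := exists_norm_canonicalFactor_sub_one_le hs
  have hsummable : Summable fun k => ‖canonicalFactor s (z k) w - 1‖ := by
    refine Summable.of_nonneg_of_le (fun _ => norm_nonneg _)
      (fun k => hF _ _ (hz.norm_lt_one k) hw) (Summable.mul_left C ?_)
    exact summable_of_sum_le (fun _ => by positivity) (hsum w hw)
  have h1 := tprod_one_add_ne_zero_of_summable (f := fun k => canonicalFactor s (z k) w - 1)
    (fun k => by
      rw [add_sub_cancel]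
      exact canonicalFactor_ne_zero (hz.norm_lt_one k) hw (h k)) hsummable
  simpa only [add_sub_cancel, canonicalProduct] using h1

open Classical in
/-- The product of all canonical factors except the one with index `n`. -/
def deletedProduct (z : ℕ → ℂ) (s n : ℕ) (w : ℂ) : ℂ :=
  ∏' k : ℕ, if k = n then 1 else canonicalFactor s (z k) w

theorem hasProdLocallyUniformlyOn_deletedProduct (hz : IsSparse z φ) (hφ : IsGrowth φ s)
    (hs : 1 ≤ s) (n : ℕ) :
    HasProdLocallyUniformlyOn (fun k w => if k = n then 1 else canonicalFactor s (z k) w)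
      (deletedProduct z s n) (Metric.ball 0 1) ∧
    DifferentiableOn ℂ (deletedProduct z s n) (Metric.ball 0 1) := by
  obtain ⟨C, hC, h⟩ := exists_norm_canonicalFactor_sub_one_le hs
  have hd : ∀ k, DifferentiableOn ℂ (fun w => if k = n then 1 else canonicalFactor s (z k) w)
      (Metric.ball 0 1) := fun k => by
    split_ifs
    · exact differentiableOn_const _
    · exact differentiableOn_canonicalFactor s (hz.norm_lt_one k).le
  have hp : HasProdLocallyUniformlyOn
      (fun k w => if k = n then 1 else canonicalFactor s (z k) w)
      (deletedProduct z s n) (Metric.ball 0 1) := by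
    have := hasProdLocallyUniformlyOn_of_kernelA hz hφ hs hC.le
      (f := fun k w => if k = n then 1 else canonicalFactor s (z k) w) (fun k w hw => ?_) hd
    · convert this using 1
      funext w
      simp only [deletedProduct]
    · split_ifs
      · rw [sub_self, norm_zero]
        positivity
      · exact h _ _ (hz.norm_lt_one k) hw
  exact ⟨hp, hp.differentiableOn_of_forall hd Metric.isOpen_ball⟩

theorem canonicalProduct_eq_mul (hz : IsSparse z φ) (hφ : IsGrowth φ s) (hs : 1 ≤ s) (n : ℕ)
    {w : ℂ} (hw : ‖w‖ < 1) : canonicalProduct z s w =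
      (w - z n) * (canonicalCofactor s (z n) w * deletedProduct z s n w) := by
  classical
  have hp := (hasProdLocallyUniformlyOn_deletedProduct hz hφ hs n).1.hasProd
    (mem_ball_zero_iff.2 hw)
  have h1 : Multipliable (Function.update (fun k => canonicalFactor s (z k) w) n 1) := by
    convert hp.multipliable using 1
    funext k
    simp [Function.update_apply]
  have h := Multipliable.tprod_eq_mul_tprod_ite' n h1
  rw [← mul_assoc, ← canonicalFactor_eq_mul (hz.norm_lt_one n) hw, canonicalProduct, h,
    deletedProduct]

theorem canonicalProduct_apply_eq_zero (hz : IsSparse z φ) (hφ : IsGrowth φ s) (hs : 1 ≤ s)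
    (n : ℕ) : canonicalProduct z s (z n) = 0 := by
  rw [canonicalProduct_eq_mul hz hφ hs n (hz.norm_lt_one n), sub_self, zero_mul]

theorem deriv_canonicalProduct (hz : IsSparse z φ) (hφ : IsGrowth φ s) (hs : 1 ≤ s) (n : ℕ) :
    deriv (canonicalProduct z s) (z n) =
      canonicalCofactor s (z n) (z n) * deletedProduct z s n (z n) := by
  have hn := hz.norm_lt_one n
  have hball : Metric.ball (0 : ℂ) 1 ∈ 𝓝 (z n) :=
    Metric.isOpen_ball.mem_nhds (mem_ball_zero_iff.2 hn)
  have hg := (((differentiableOn_canonicalCofactor s hn.le).mul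
    (hasProdLocallyUniformlyOn_deletedProduct hz hφ hs n).2).differentiableAt hball).hasDerivAt
  have h1 := ((hasDerivAt_id (z n)).sub_const (z n)).mul hg
  have h2 : canonicalProduct z s =ᶠ[𝓝 (z n)] fun w =>
      (w - z n) * (canonicalCofactor s (z n) w * deletedProduct z s n w) := by
    filter_upwards [hball] with w hw
    exact canonicalProduct_eq_mul hz hφ hs n (mem_ball_zero_iff.1 hw)
  rw [h2.deriv_eq]
  refine h1.deriv.trans ?_
  simp

/-- The factor lower bounds multiply over `k ≠ n`: the kernel terms add up to `O(T)` and the `log⁺`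
terms are bounded by the separation hypothesis. -/
theorem exists_le_norm_deriv_canonicalProduct (hz : IsSparse z φ) (hφ : IsGrowth φ s)
    (hs : 1 ≤ s) :
    ∃ C : ℝ, 0 < C ∧ ∀ n, Real.exp (-(C * partialSum φ (level (z n))))
      ≤ ‖deriv (canonicalProduct z s) (z n)‖ := by
  obtain ⟨c, hc, hc1, hzc⟩ := exists_le_norm hz hφ hs
  obtain ⟨B, hB, hsum⟩ := exists_sum_kernelA_le hz hφ hs
  obtain ⟨C, hC, hF⟩ := exists_le_norm_canonicalFactor hs hc hc1
  obtain ⟨K, hK, hlogs⟩ := hz.exists_sum_posLog_le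
  have hlog : 0 ≤ Real.log (1 / c) := Real.log_nonneg (by rw [le_div_iff₀ hc]; linarith)
  refine ⟨Real.log (1 / c) + (C * B + K), by positivity, fun n => ?_⟩
  have hn := hz.norm_lt_one n
  set T := partialSum φ (level (z n)) with hT
  have hT1 : 1 ≤ T := one_le_partialSum hφ _
  have hdel : Real.exp (-((C * B + K) * T)) ≤ ‖deletedProduct z s n (z n)‖ := by
    classical
    set b : ℕ → ℝ := fun k => if k = n then 0 else
      C * ‖kernelA (z k) (z n)‖ ^ (s + 1) + Real.posLog ((1 - ‖z n‖) / 2 / ‖z k - z n‖) with hb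
    have hp := (hasProdLocallyUniformlyOn_deletedProduct hz hφ hs n).1.hasProd
      (mem_ball_zero_iff.2 hn)
    rw [← hp.tprod_eq]
    refine exp_neg_le_norm_tprod (b := b) hp.multipliable (fun k => ?_) fun S => ?_
    · simp only [hb]
      split_ifs with hkn
      · simp
      -- If `z k = 0` then `z n ≠ 0` by injectivity, so `c ≤ ‖z n‖`.
      · refine hF _ _ (hz.norm_lt_one k) hn (hz.injective.ne hkn) (fun h0 => hzc n ?_) (hzc k)
        rw [← h0]
        exact (hz.injective.ne hkn).symm
    · have h1 : ∑ k ∈ S, b k = ∑ k ∈ S.erase n, b k := by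
        rw [Finset.sum_erase]
        simp [hb]
      have h2 : ∑ k ∈ S.erase n, b k = C * ∑ k ∈ S.erase n, ‖kernelA (z k) (z n)‖ ^ (s + 1)
          + ∑ k ∈ S.erase n, Real.posLog ((1 - ‖z n‖) / 2 / ‖z k - z n‖) := by
        rw [Finset.mul_sum, ← Finset.sum_add_distrib]
        exact Finset.sum_congr rfl fun k hk => if_neg (Finset.ne_of_mem_erase hk)
      rw [h1, h2]
      calc _ ≤ C * (B * T) + K * φ (level (z n)) := by
            gcongr
            · exact hsum _ hn _
            · exact hlogs n _ (Finset.notMem_erase _ _)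
        _ ≤ C * (B * T) + K * T := by
            gcongr
            exact le_partialSum hφ _
        _ = _ := by ring
  rw [deriv_canonicalProduct hz hφ hs, norm_mul]
  have hcof := le_norm_canonicalCofactor (s := s) hn hc1 (hzc n)
  calc Real.exp (-((Real.log (1 / c) + (C * B + K)) * T))
      ≤ Real.exp (-Real.log (1 / c) + -((C * B + K) * T)) := by
        rw [Real.exp_le_exp]
        nlinarith
    _ = c * Real.exp (-((C * B + K) * T)) := by
        rw [Real.exp_add, Real.exp_neg, Real.exp_log (by positivity), one_div, inv_inv]
    _ ≤ _ := by gcongr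

end Product

/-! ### The interpolation series -/

section Series

variable {z : ℕ → ℂ} {φ : ℕ → ℝ} {s : ℕ}

theorem inv_dist_le_exp (hφ : IsGrowth φ s) (w : ℂ) :
    1 / (1 - ‖w‖) ≤ Real.exp (partialSum φ (level w)) := by
  refine lt_pow_level.le.trans ?_
  have h2 : (2 : ℝ) ≤ Real.exp 1 := by linarith [Real.add_one_le_exp (1 : ℝ)]
  calc (2 : ℝ) ^ (level w + 1) ≤ Real.exp 1 ^ (level w + 1) := by gcongr
    _ = Real.exp (level w + 1) := by rw [← Real.exp_nat_mul]; push_cast; ring_nf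
    _ ≤ _ := Real.exp_le_exp.2 (succ_le_partialSum hφ _)

/-- Far from `z n` one divides by the distance. Within `(1 - ‖z n‖) / 2` the Schwarz lemma applies,
as the level there exceeds that of `z n` by at most one. -/
theorem exists_norm_dslope_canonicalProduct_le (hz : IsSparse z φ) (hφ : IsGrowth φ s)
    (hs : 1 ≤ s) :
    ∃ C : ℝ, 0 < C ∧ ∀ (n : ℕ) (w : ℂ), ‖w‖ < 1 → ‖dslope (canonicalProduct z s) (z n) w‖ ≤
      Real.exp (C * (partialSum φ (level w) + partialSum φ (level (z n)))) := by
  obtain ⟨C, hC, hP⟩ := exists_norm_canonicalProduct_le hz hφ hs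
  obtain ⟨D, hD, hT⟩ := exists_partialSum_add_le hφ
  refine ⟨C * D + 2, by positivity, fun n w hw => ?_⟩
  have hn := hz.norm_lt_one n
  set T := partialSum φ (level w)
  set U := partialSum φ (level (z n))
  have hT1 : 1 ≤ T := one_le_partialSum hφ _
  have hU1 : 1 ≤ U := one_le_partialSum hφ _
  have hd : 0 < 1 - ‖z n‖ := by linarith
  have hinv : ((1 - ‖z n‖) / 2)⁻¹ ≤ Real.exp (2 * U) := by
    have h2 : (2 : ℝ) ≤ Real.exp U := by linarith [Real.add_one_le_exp U]
    calc ((1 - ‖z n‖) / 2)⁻¹ = 2 * (1 / (1 - ‖z n‖)) := by field_simp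
      _ ≤ Real.exp U * Real.exp U := by
          have := inv_dist_le_exp hφ (z n)
          gcongr
      _ = _ := by rw [← Real.exp_add]; ring_nf
  have hPn := canonicalProduct_apply_eq_zero hz hφ hs n
  have hbig : ∀ X, 0 ≤ X → X ≤ C * D * (T + U) →
      Real.exp X * ((1 - ‖z n‖) / 2)⁻¹ ≤ Real.exp ((C * D + 2) * (T + U)) := fun X _ hX => by
    calc Real.exp X * ((1 - ‖z n‖) / 2)⁻¹ ≤ Real.exp X * Real.exp (2 * U) := by gcongr
      _ = Real.exp (X + 2 * U) := (Real.exp_add _ _).symm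
      _ ≤ _ := by
          rw [Real.exp_le_exp]
          linarith
  rcases lt_or_ge (dist w (z n)) ((1 - ‖z n‖) / 2) with h | h
  · have hball : ∀ v ∈ Metric.ball (z n) ((1 - ‖z n‖) / 2),
        ‖v‖ < 1 ∧ level v ≤ level (z n) + 1 := by
      intro v hv
      rw [mem_ball_iff_norm] at hv
      have h1 : ‖v‖ ≤ ‖z n‖ + ‖v - z n‖ := by
        have := norm_add_le (z n) (v - z n)
        rwa [add_sub_cancel] at this
      have h2 : ‖v‖ < 1 := by linarith
      exact ⟨h2, level_le_of_dist_le h2 hn (by rw [pow_one]; linarith)⟩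
    have h1 := Complex.norm_dslope_le_div_of_mapsTo_ball (f := canonicalProduct z s) (c := z n)
      (R₁ := (1 - ‖z n‖) / 2) (R₂ := Real.exp (C * (D * U))) (z := w)
      ((differentiableOn_canonicalProduct hz hφ hs).mono fun v hv =>
        mem_ball_zero_iff.2 (hball v hv).1)
      (fun v hv => by
        obtain ⟨hv1, hv2⟩ := hball v hv
        rw [mem_closedBall_iff_norm, hPn, sub_zero]
        refine (hP v hv1).trans ?_
        rw [Real.exp_le_exp]
        gcongr
        have := hT 1 (level (z n))
        rw [pow_one] at this
        exact (partialSum_mono hφ hv2).trans this) h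
    refine h1.trans ?_
    rw [div_eq_mul_inv]
    refine hbig _ (by positivity) ?_
    have : 0 ≤ C * D * T := by positivity
    linarith
  · have hne : w ≠ z n := by
      rintro rfl
      rw [dist_self] at h
      linarith
    rw [dslope_of_ne _ hne, slope_def_field, hPn, sub_zero, norm_div, div_eq_mul_inv]
    rw [dist_eq_norm] at h
    calc ‖canonicalProduct z s w‖ * ‖w - z n‖⁻¹
        ≤ Real.exp (C * T) * ((1 - ‖z n‖) / 2)⁻¹ := by
          gcongr
          exact hP w hw
      _ ≤ _ := by
          refine hbig _ (by positivity) ?_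
          have h1 : 0 ≤ C * U := by positivity
          have h2 : C * (T + U) ≤ C * (T + U) * D := le_mul_of_one_le_right (by positivity) hD
          linarith

/-- If `a` is at least three levels above `w`, then `‖A‖ ≤ 1/2 ≤ exp (-1/2)`, whence the `2` in the
exponent. Otherwise `U ≤ D ^ 2 * T`, and `‖A‖ ≤ 2 ≤ e` loses only `exp (2 * X * U + 1)`. -/
theorem exists_norm_kernelA_pow_le (hφ : IsGrowth φ s) {X : ℝ} (hX : 0 ≤ X) :
    ∃ C : ℝ, 0 < C ∧ ∀ a w : ℂ, ‖a‖ < 1 → ‖w‖ < 1 →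
      ‖kernelA a w‖ ^ ⌈2 * X * partialSum φ (level a)⌉₊ ≤
        Real.exp (C * partialSum φ (level w) - X * partialSum φ (level a)) := by
  obtain ⟨D, hD, hT⟩ := exists_partialSum_add_le hφ
  refine ⟨3 * X * D ^ 2 + 1, by positivity, fun a w ha hw => ?_⟩
  set T := partialSum φ (level w)
  set U := partialSum φ (level a)
  have hT1 : 1 ≤ T := one_le_partialSum hφ _
  have hU1 : 1 ≤ U := one_le_partialSum hφ _
  rcases le_or_gt (level w + 3) (level a) with h | h
  · have hA : ‖kernelA a w‖ ≤ 1 / 2 := by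
      refine (norm_kernelA_le_div ha hw).trans ?_
      rw [div_le_iff₀ (by linarith)]
      have h1 := dist_mul_pow_level_le ha
      have h2 := lt_dist_mul_pow_level hw
      have h3 : (2 : ℝ) ^ (level w + 1) * 4 ≤ 2 ^ level a := by
        calc (2 : ℝ) ^ (level w + 1) * 4 = 2 ^ (level w + 3) := by ring
          _ ≤ 2 ^ level a := pow_le_pow_right₀ (by norm_num) h
      have h4 : (1 - ‖a‖) * (2 ^ (level w + 1) * 4) ≤ (1 - ‖w‖) * 2 ^ (level w + 1) := by
        have h5 : (1 - ‖a‖) * (2 ^ (level w + 1) * 4) ≤ (1 - ‖a‖) * 2 ^ level a := by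
          gcongr
        linarith
      have h5 : (0 : ℝ) < 2 ^ (level w + 1) := by positivity
      have h6 : (1 - ‖a‖) * 4 ≤ 1 - ‖w‖ := by
        refine le_of_mul_le_mul_right ?_ h5
        linarith
      linarith
    have hhalf : (1 / 2 : ℝ) ≤ Real.exp (-(1 / 2)) := by
      linarith [Real.add_one_le_exp (-(1 / 2) : ℝ)]
    calc ‖kernelA a w‖ ^ ⌈2 * X * U⌉₊ ≤ Real.exp (-(1 / 2)) ^ ⌈2 * X * U⌉₊ := by
          gcongr
          exact hA.trans hhalf
      _ = Real.exp (⌈2 * X * U⌉₊ * -(1 / 2)) := (Real.exp_nat_mul _ _).symm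
      _ ≤ _ := by
          rw [Real.exp_le_exp]
          have := Nat.le_ceil (2 * X * U)
          have : 0 ≤ (3 * X * D ^ 2 + 1) * T := by positivity
          linarith
  · have h2 : (2 : ℝ) ≤ Real.exp 1 := by linarith [Real.add_one_le_exp (1 : ℝ)]
    have hUT : U ≤ D ^ 2 * T := (partialSum_mono hφ (by omega)).trans (hT 2 (level w))
    calc ‖kernelA a w‖ ^ ⌈2 * X * U⌉₊ ≤ Real.exp 1 ^ ⌈2 * X * U⌉₊ := by
          gcongr
          exact (norm_kernelA_le_two ha hw).trans h2
      _ = Real.exp (⌈2 * X * U⌉₊ * 1) := (Real.exp_nat_mul _ _).symm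
      _ ≤ _ := by
          rw [Real.exp_le_exp]
          have h3 := Nat.ceil_lt_add_one (show 0 ≤ 2 * X * U by positivity)
          have h4 : 3 * X * U ≤ 3 * X * (D ^ 2 * T) := by gcongr
          linarith

/-- The `n`-th term of the interpolation series. -/
def interpTerm (z : ℕ → ℂ) (s : ℕ) (b : ℕ → ℂ) (e : ℕ → ℕ) (n : ℕ) (w : ℂ) : ℂ :=
  b n / deriv (canonicalProduct z s) (z n) * dslope (canonicalProduct z s) (z n) w *
    kernelA (z n) w ^ e n

theorem exists_norm_interpTerm_le (hz : IsSparse z φ) (hφ : IsGrowth φ s) (hs : 1 ≤ s)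
    {b : ℕ → ℂ} {β : ℝ} (hβ : 0 ≤ β) (hb : ∀ n, ‖b n‖ ≤ Real.exp (β * partialSum φ (level (z n)))) :
    ∃ X C : ℝ, 0 ≤ X ∧ 0 < C ∧ ∀ (n : ℕ) (w : ℂ), ‖w‖ < 1 →
      ‖interpTerm z s b (fun n => ⌈X * partialSum φ (level (z n))⌉₊) n w‖ ≤
        Real.exp (C * partialSum φ (level w)) * (1 - ‖z n‖) ^ (s + 1) := by
  obtain ⟨C₁, hC₁, hderiv⟩ := exists_le_norm_deriv_canonicalProduct hz hφ hs
  obtain ⟨C₂, hC₂, hslope⟩ := exists_norm_dslope_canonicalProduct_le hz hφ hs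
  -- The summands offset `b n`, `1 / P'(z n)` and the divided difference; `s + 1` leaves the
  -- summable factor `(1 - ‖z n‖) ^ (s + 1)`.
  set X : ℝ := β + C₁ + C₂ + (s + 1) with hX
  have hX0 : 0 ≤ X := by positivity
  obtain ⟨C₃, hC₃, hker⟩ := exists_norm_kernelA_pow_le hφ hX0
  refine ⟨2 * X, C₂ + C₃, by positivity, by positivity, fun n w hw => ?_⟩
  have hn := hz.norm_lt_one n
  set T := partialSum φ (level w)
  set U := partialSum φ (level (z n)) with hU
  have hd : 0 < 1 - ‖z n‖ := by linarith
  have hexpU : Real.exp (-U) ≤ 1 - ‖z n‖ := by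
    have := inv_dist_le_exp hφ (z n)
    rw [Real.exp_neg, inv_le_comm₀ (Real.exp_pos _) hd]
    simpa using this
  have hdinv : ‖deriv (canonicalProduct z s) (z n)‖⁻¹ ≤ Real.exp (C₁ * U) := by
    rw [inv_le_comm₀ ((Real.exp_pos _).trans_le (hderiv n)) (Real.exp_pos _), ← Real.exp_neg]
    exact hderiv n
  rw [interpTerm, norm_mul, norm_mul, norm_div, norm_pow, div_eq_mul_inv]
  calc ‖b n‖ * ‖deriv (canonicalProduct z s) (z n)‖⁻¹ * ‖dslope (canonicalProduct z s) (z n) w‖ *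
        ‖kernelA (z n) w‖ ^ ⌈2 * X * U⌉₊
      ≤ Real.exp (β * U) * Real.exp (C₁ * U) * Real.exp (C₂ * (T + U)) *
        Real.exp (C₃ * T - X * U) := by
        gcongr
        · exact hb n
        · exact hslope n w hw
        · exact hker _ _ hn hw
    _ = Real.exp ((C₂ + C₃) * T) * Real.exp (-U) ^ (s + 1) := by
        rw [← Real.exp_add, ← Real.exp_add, ← Real.exp_add, ← Real.exp_nat_mul, ← Real.exp_add]
        congr 1
        rw [hX]
        push_cast
        ring
    _ ≤ _ := by gcongr

theorem interpTerm_eq (hz : IsSparse z φ) (hφ : IsGrowth φ s) (hs : 1 ≤ s) (b : ℕ → ℂ) (e : ℕ → ℕ)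
    {n : ℕ} {w : ℂ} (h : w ≠ z n) :
    interpTerm z s b e n w = b n / (w - z n) *
      (canonicalProduct z s w / deriv (canonicalProduct z s) (z n)) * kernelA (z n) w ^ e n := by
  rw [interpTerm, dslope_of_ne _ h, slope_def_field, canonicalProduct_apply_eq_zero hz hφ hs n]
  ring

theorem exists_interpolation (hz : IsSparse z φ) (hφ : IsGrowth φ s) (hs : 1 ≤ s)
    {b : ℕ → ℂ} {β : ℝ} (hβ : 0 ≤ β) (hb : ∀ n, ‖b n‖ ≤ Real.exp (β * partialSum φ (level (z n)))) :
    ∃ f : ℂ → ℂ, DifferentiableOn ℂ f (Metric.ball 0 1) ∧ (∀ n, f (z n) = b n) ∧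
      (∃ C : ℝ, 0 < C ∧ ∀ w : ℂ, ‖w‖ < 1 → ‖f w‖ ≤ Real.exp (C * partialSum φ (level w))) ∧
      ∃ e : ℕ → ℕ, (∀ m n, ‖z m‖ ≤ ‖z n‖ → e m ≤ e n) ∧
        ∀ w : ℂ, ‖w‖ < 1 → HasSum (fun n => interpTerm z s b e n w) (f w) := by
  obtain ⟨X, C, hX, hC, hterm⟩ := exists_norm_interpTerm_le hz hφ hs hβ hb
  set e : ℕ → ℕ := fun n => ⌈X * partialSum φ (level (z n))⌉₊
  have hsum := summable_dist_pow hz hφ hs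
  have hsummable : ∀ w : ℂ, ‖w‖ < 1 → Summable fun n => ‖interpTerm z s b e n w‖ := fun w hw =>
    Summable.of_nonneg_of_le (fun _ => norm_nonneg _) (fun n => hterm n w hw) (hsum.mul_left _)
  have hpos : ∀ n, 0 ≤ (1 - ‖z n‖) ^ (s + 1) := fun n => by
    have := hz.norm_lt_one n
    exact pow_nonneg (by linarith) _
  refine ⟨fun w => ∑' n, interpTerm z s b e n w, ?_, fun m => ?_,
    ⟨C + ∑' n, (1 - ‖z n‖) ^ (s + 1), ?_, fun w hw => ?_⟩, e, fun m n hmn => ?_,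
    fun w hw => (hsummable w hw).of_norm.hasSum⟩
  · intro v hv
    have hv1 : ‖v‖ < 1 := mem_ball_zero_iff.1 hv
    set r : ℝ := (‖v‖ + 1) / 2 with hr
    have hr0 : 0 ≤ r := by positivity
    have hrn : ‖(r : ℂ)‖ = r := by rw [Complex.norm_real, Real.norm_of_nonneg hr0]
    have hsub : ∀ w ∈ Metric.ball (0 : ℂ) r, ‖w‖ < 1 := fun w hw => by
      have := mem_ball_zero_iff.1 hw
      linarith
    have h := Complex.differentiableOn_tsum_of_summable_norm
      (F := fun n w => interpTerm z s b e n w) (U := Metric.ball 0 r)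
      (hsum.mul_left (Real.exp (C * partialSum φ (level r)))) (fun n => ?_) Metric.isOpen_ball
      fun n w hw => ?_
    · exact ((h.differentiableAt (Metric.isOpen_ball.mem_nhds
        (mem_ball_zero_iff.2 (by linarith)))).differentiableWithinAt)
    · have hn := hz.norm_lt_one n
      have hball : Metric.ball (0 : ℂ) 1 ∈ 𝓝 (z n) :=
        Metric.isOpen_ball.mem_nhds (mem_ball_zero_iff.2 hn)
      refine DifferentiableOn.mono (t := Metric.ball 0 1) ?_ fun w hw =>
        mem_ball_zero_iff.2 (hsub w hw)
      exact (((Complex.differentiableOn_dslope hball).2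
        (differentiableOn_canonicalProduct hz hφ hs)).const_mul _).mul
          ((differentiableOn_kernelA hn.le).pow _)
    · refine (hterm n w (hsub w hw)).trans (mul_le_mul_of_nonneg_right ?_ (hpos n))
      rw [Real.exp_le_exp]
      gcongr
      refine partialSum_mono hφ (level_le_level (by rw [hrn]; linarith) ?_)
      rw [hrn]
      exact (mem_ball_zero_iff.1 hw).le
  · have hP := canonicalProduct_apply_eq_zero hz hφ hs
    have hm : deriv (canonicalProduct z s) (z m) ≠ 0 := by
      obtain ⟨C₁, -, hderiv⟩ := exists_le_norm_deriv_canonicalProduct hz hφ hs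
      exact norm_pos_iff.1 ((Real.exp_pos _).trans_le (hderiv m))
    refine (tsum_eq_single m fun n hnm => ?_).trans ?_
    · rw [interpTerm_eq hz hφ hs b e (hz.injective.ne hnm.symm), hP]
      simp
    · rw [interpTerm, dslope_same, kernelA_self (hz.norm_lt_one m), one_pow, mul_one,
        div_mul_cancel₀ _ hm]
  · have : 0 ≤ ∑' n, (1 - ‖z n‖) ^ (s + 1) := tsum_nonneg hpos
    positivity
  · set T := partialSum φ (level w)
    have hT1 : 1 ≤ T := one_le_partialSum hφ _
    set S := ∑' n, (1 - ‖z n‖) ^ (s + 1)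
    have hS0 : 0 ≤ S := tsum_nonneg hpos
    calc ‖∑' n, interpTerm z s b e n w‖
        ≤ ∑' n, Real.exp (C * T) * (1 - ‖z n‖) ^ (s + 1) :=
          tsum_of_norm_bounded (hsum.mul_left _).hasSum fun n => hterm n w hw
      _ = Real.exp (C * T) * S := tsum_mul_left
      _ ≤ Real.exp (C * T) * Real.exp (S * T) := by
          gcongr
          nlinarith [Real.add_one_le_exp (S * T)]
      _ = _ := by rw [← Real.exp_add, add_mul]
  · refine Nat.ceil_mono ?_
    gcongr
    exact partialSum_mono hφ (level_le_level (hz.norm_lt_one n) hmn)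

end Series

/-! ### Growth of the maximum modulus -/

theorem log_maxModulus_le {f : ℂ → ℂ} {r B : ℝ} (hr : 0 ≤ r) (hB : 0 ≤ B)
    (h : ∀ w : ℂ, ‖w‖ = r → ‖f w‖ ≤ Real.exp B) : Real.log (maxModulus f r) ≤ B := by
  have hne : ((fun w : ℂ => ‖f w‖) '' Metric.sphere (0 : ℂ) r).Nonempty :=
    (NormedSpace.sphere_nonempty.2 hr).image _
  have h1 : maxModulus f r ≤ Real.exp B := by
    refine csSup_le hne ?_
    rintro _ ⟨w, hw, rfl⟩
    exact h w (mem_sphere_zero_iff_norm.1 hw)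
  have h0 : 0 ≤ maxModulus f r := by
    refine Real.sSup_nonneg ?_
    rintro _ ⟨w, -, rfl⟩
    exact norm_nonneg _
  rcases h0.eq_or_lt with h0 | h0
  -- `Real.log 0 = 0`, so `0 ≤ B` is needed when `f` vanishes on the circle.
  · rw [← h0, Real.log_zero]
    exact hB
  · rwa [Real.log_le_iff_le_exp h0]

section Final

variable {ψ : ℝ → ℝ}

theorem le_level_of_lt {r : ℝ} (hr0 : 0 ≤ r) (hr1 : r < 1) {J : ℕ} (h : 1 - 1 / 2 ^ J ≤ r) :
    J ≤ level (r : ℂ) := by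
  have h1 := lt_pow_level (w := (r : ℂ))
  rw [Complex.norm_real, Real.norm_of_nonneg hr0] at h1
  have h2 : (2 : ℝ) ^ J ≤ 1 / (1 - r) := by
    rw [le_div_iff₀ (by linarith)]
    have h3 : (0 : ℝ) < 2 ^ J := by positivity
    calc (2 : ℝ) ^ J * (1 - r) ≤ 2 ^ J * (1 / 2 ^ J) := by gcongr; linarith
      _ = 1 := by field_simp
  have := (pow_lt_pow_iff_right₀ (by norm_num : (1 : ℝ) < 2)).1 (h2.trans_lt h1)
  omega

theorem exists_log_maxModulus_le (hψ_nonneg : ∀ x : ℝ, 1 ≤ x → 0 ≤ ψ x)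
    (hψ_mono : MonotoneOn ψ (Set.Ici 1)) (hψ_unbdd : ¬ BddAbove (ψ '' Set.Ici 1))
    (hg : IsGrowth (dyadic ψ) (genus ψ)) {f : ℂ → ℂ} {C : ℝ} (hC : 0 < C)
    (hf : ∀ w : ℂ, ‖w‖ < 1 → ‖f w‖ ≤ Real.exp (C * partialSum (dyadic ψ) (level w))) :
    ∃ C' : ℝ, 0 < C' ∧ ∃ r₀ < 1, ∀ r, 0 ≤ r → r₀ ≤ r → r < 1 →
      Real.log (maxModulus f r) ≤ C' * tildeFn ψ (1 / (1 - r)) := by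
  obtain ⟨B, hB, J, hJ⟩ := exists_partialSum_le_tildeFn hψ_nonneg hψ_mono hψ_unbdd hg
  refine ⟨C * B, by positivity, 1 - 1 / 2 ^ J, ?_, fun r hr0 hrJ hr1 => ?_⟩
  · have : (0 : ℝ) < 1 / 2 ^ J := by positivity
    linarith
  · have hrn : ‖(r : ℂ)‖ = r := by rw [Complex.norm_real, Real.norm_of_nonneg hr0]
    have h1 := hJ r (by rwa [hrn]) (le_level_of_lt hr0 hr1 hrJ)
    rw [hrn] at h1
    have h2 := one_le_partialSum hg (level (r : ℂ))
    refine (log_maxModulus_le (B := C * partialSum (dyadic ψ) (level (r : ℂ))) hr0 (by positivity)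
      fun w hw => ?_).trans ?_
    · have h3 : level w = level (r : ℂ) := by rw [level, level, hrn, hw]
      rw [← h3]
      exact hf w (by rwa [hw])
    · rw [mul_assoc]
      gcongr

/-- As `r → 0` the bound tends to `0` linearly, since `ψ̃ (1 / (1 - r)) ≥ ψ 1 * log (1 / (1 - r)) ≥
ψ 1 * r`. This matches `‖f w‖ ≤ 1 + L * r ≤ exp (L * r)`. -/
theorem exists_log_maxModulus_le_of_norm_zero_le (hψ_nonneg : ∀ x : ℝ, 1 ≤ x → 0 ≤ ψ x)
    (hψ_mono : MonotoneOn ψ (Set.Ici 1)) (hψ_unbdd : ¬ BddAbove (ψ '' Set.Ici 1))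
    (hg : IsGrowth (dyadic ψ) (genus ψ)) (hψ1 : 0 < ψ 1) {f : ℂ → ℂ} {C : ℝ} (hC : 0 < C)
    (hf : ∀ w : ℂ, ‖w‖ < 1 → ‖f w‖ ≤ Real.exp (C * partialSum (dyadic ψ) (level w)))
    (hd : DifferentiableOn ℂ f (Metric.ball 0 1)) (h0 : ‖f 0‖ ≤ 1) :
    ∃ C' : ℝ, 0 < C' ∧ ∀ r, 0 < r → r < 1 →
      Real.log (maxModulus f r) ≤ C' * tildeFn ψ (1 / (1 - r)) := by
  obtain ⟨B, hB, r₀, hr₀, hlarge⟩ :=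
    exists_log_maxModulus_le hψ_nonneg hψ_mono hψ_unbdd hg hC hf
  have hcont : ContinuousOn (dslope f 0) (Metric.closedBall 0 r₀) :=
    ((Complex.differentiableOn_dslope (Metric.ball_mem_nhds 0 one_pos)).2 hd).continuousOn.mono
      (Metric.closedBall_subset_ball hr₀)
  obtain ⟨K, hK⟩ := (isCompact_closedBall (0 : ℂ) r₀).exists_bound_of_continuousOn hcont
  set L : ℝ := max K 0
  have hL : 0 ≤ L := le_max_right _ _
  refine ⟨max B (L / ψ 1), lt_max_of_lt_left hB, fun r hr hr1 => ?_⟩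
  have hinv : 1 ≤ 1 / (1 - r) := by
    rw [le_div_iff₀ (by linarith)]
    linarith
  have htilde : ψ 1 * r ≤ tildeFn ψ (1 / (1 - r)) := by
    refine le_trans ?_ (le_integral_div hψ_mono le_rfl hinv (c := ψ 1) fun t ht =>
      hψ_mono Set.self_mem_Ici ht.1 ht.1)
    gcongr
    have := Real.one_sub_inv_le_log_of_pos (show 0 < 1 / (1 - r) / 1 by positivity)
    refine le_trans (le_of_eq ?_) this
    simp
  have ht0 : 0 ≤ tildeFn ψ (1 / (1 - r)) := le_trans (by positivity) htilde
  rcases le_total r₀ r with h | h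
  · refine (hlarge r hr.le h hr1).trans ?_
    gcongr
    exact le_max_left _ _
  · refine (log_maxModulus_le (B := L * r) hr.le (by positivity) fun w hw => ?_).trans ?_
    · have hfw : f w = f 0 + w * dslope f 0 w := by
        have := sub_smul_dslope f 0 w
        rw [sub_zero, smul_eq_mul] at this
        rw [this]
        ring
      have hKw : ‖dslope f 0 w‖ ≤ L :=
        (hK w (mem_closedBall_zero_iff.2 (by rwa [hw]))).trans (le_max_left _ _)
      calc ‖f w‖ ≤ ‖f 0‖ + ‖w‖ * ‖dslope f 0 w‖ := by
            rw [hfw, ← norm_mul]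
            simpa using norm_add_le (f 0) (w * dslope f 0 w)
        _ ≤ 1 + r * L := by
            rw [hw]
            gcongr
        _ ≤ Real.exp (L * r) := by linarith [Real.add_one_le_exp (L * r)]
    · calc L * r = L / ψ 1 * (ψ 1 * r) := by field_simp
        _ ≤ max B (L / ψ 1) * tildeFn ψ (1 / (1 - r)) := by
            gcongr
            exact le_max_right _ _

end Final

end DiscInterp

end

/-! ### The interpolation theorem -/

theorem mainTheorem1
    (z : ℕ → ℂ) (hz_inj : Function.Injective z) (hz_disc : ∀ n, ‖z n‖ < 1)
    (ψ : ℝ → ℝ) (hψ_nonneg : ∀ x : ℝ, 1 ≤ x → 0 ≤ ψ x)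
    (hψ_mono : MonotoneOn ψ (Set.Ici 1))
    (hψ_unbdd : ¬ BddAbove (ψ '' Set.Ici 1))
    (hψ_polya : (fun x : ℝ => ψ (2 * x)) =O[atTop] ψ)
    (hN : ∃ C : ℝ, 0 < C ∧ ∀ n : ℕ,
      DiscInterp.countIntegral z (z n) ((1 - ‖z n‖) / 2) ≤
        ENNReal.ofReal (C * ψ (1 / (1 - ‖z n‖)))) :
    -- the canonical product converges and has simple zeros at the points of the sequence
    (MultipliableLocallyUniformlyOn
        (fun (n : ℕ) (w : ℂ) => DiscInterp.canonicalFactor (DiscInterp.genus ψ) (z n) w)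
        (Metric.ball (0 : ℂ) 1) ∧
      ∀ n : ℕ, deriv (DiscInterp.canonicalProduct z (DiscInterp.genus ψ)) (z n) ≠ 0) ∧
    ∀ b : ℕ → ℂ,
      (∃ C : ℝ, 0 < C ∧ ∀ n : ℕ,
        Real.log ‖b n‖ ≤ C * DiscInterp.tildeFn ψ (1 / (1 - ‖z n‖))) →
      -- an interpolating function of the required growth, given by an explicit series
      (∃ f : ℂ → ℂ,
        DifferentiableOn ℂ f (Metric.ball (0 : ℂ) 1) ∧
        (∀ n : ℕ, f (z n) = b n) ∧
        (∃ C : ℝ, 0 < C ∧ ∀ᶠ r : ℝ in 𝓝[<] 1,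
          Real.log (DiscInterp.maxModulus f r) ≤ C * DiscInterp.tildeFn ψ (1 / (1 - r))) ∧
        ∃ s : ℕ → ℕ, (∀ n : ℕ, 1 ≤ s n) ∧
          (∀ m n : ℕ, ‖z m‖ ≤ ‖z n‖ → s m ≤ s n) ∧
          ∀ w : ℂ, ‖w‖ < 1 → (∀ n : ℕ, w ≠ z n) →
            HasSum
              (fun n : ℕ => b n / (w - z n) *
                (DiscInterp.canonicalProduct z (DiscInterp.genus ψ) w /
                  deriv (DiscInterp.canonicalProduct z (DiscInterp.genus ψ)) (z n)) *
                DiscInterp.kernelA (z n) w ^ (s n - 1))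
              (f w)) ∧
      -- the growth estimate on the whole of `(0, 1)` when `ψ` is positive
      (0 < ψ 1 → ∃ f : ℂ → ℂ,
        DifferentiableOn ℂ f (Metric.ball (0 : ℂ) 1) ∧
        (∀ n : ℕ, f (z n) = b n) ∧
        ∃ C : ℝ, 0 < C ∧ ∀ r : ℝ, 0 < r → r < 1 →
          Real.log (DiscInterp.maxModulus f r) ≤ C * DiscInterp.tildeFn ψ (1 / (1 - r))) := by
  have hg := DiscInterp.isGrowth_dyadic hψ_nonneg hψ_mono hψ_polya
  have hs : 1 ≤ DiscInterp.genus ψ := Nat.succ_le_succ (Nat.zero_le _)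
  have hz := DiscInterp.isSparse hz_inj hz_disc hψ_mono hg hN
  have hP := DiscInterp.hasProdLocallyUniformlyOn_canonicalProduct hz hg hs
  refine ⟨⟨hP.multipliableLocallyUniformlyOn, fun n => ?_⟩, fun b ⟨C, hC, hb⟩ => ?_⟩
  · obtain ⟨C, -, h⟩ := DiscInterp.exists_le_norm_deriv_canonicalProduct hz hg hs
    exact norm_pos_iff.1 ((Real.exp_pos _).trans_le (h n))
  obtain ⟨D, hD, hstep⟩ := DiscInterp.exists_partialSum_add_le hg
  have hbT : ∀ n, ‖b n‖ ≤ Real.exp (C * D *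
      DiscInterp.partialSum (DiscInterp.dyadic ψ) (DiscInterp.level (z n))) := fun n => by
    rcases (norm_nonneg (b n)).eq_or_lt with h0 | h0
    · rw [← h0]
      positivity
    · rw [← Real.log_le_iff_le_exp h0, mul_assoc]
      refine (hb n).trans ?_
      gcongr
      have h1 := hstep 1 (DiscInterp.level (z n))
      rw [pow_one] at h1
      exact (DiscInterp.tildeFn_le_partialSum hψ_nonneg hψ_mono hg (hz_disc n)).trans h1
  obtain ⟨f, hfd, hfb, ⟨B, hB, hfB⟩, e, he, hsum⟩ :=
    DiscInterp.exists_interpolation hz hg hs (β := C * D) (by positivity) hbT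
  refine ⟨⟨f, hfd, hfb, ?_, fun n => e n + 1, fun n => Nat.le_add_left 1 _, fun m n hmn => ?_,
    fun w hw hwz => ?_⟩, fun hψ1 => ?_⟩
  · obtain ⟨C', hC', r₀, hr₀, h⟩ :=
      DiscInterp.exists_log_maxModulus_le hψ_nonneg hψ_mono hψ_unbdd hg hB hfB
    refine ⟨C', hC', ?_⟩
    filter_upwards [Ioo_mem_nhdsLT (max_lt one_pos hr₀)] with r hr
    exact h r ((le_max_left _ _).trans hr.1.le) ((le_max_right _ _).trans hr.1.le) hr.2
  · exact Nat.succ_le_succ (he m n hmn)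
  · convert hsum w hw using 2 with n
    rw [DiscInterp.interpTerm_eq hz hg hs b e (hwz n), Nat.add_sub_cancel]
  · by_cases h0 : ∃ m, z m = 0
    -- Here `ψ̃(1) = 0` forces `log |b m| ≤ 0`, so `|f 0| = |b m| ≤ 1` already.
    · obtain ⟨m, hm⟩ := h0
      refine ⟨f, hfd, hfb, DiscInterp.exists_log_maxModulus_le_of_norm_zero_le hψ_nonneg hψ_mono
        hψ_unbdd hg hψ1 hB hfB hfd ?_⟩
      have hbm := hb m
      rw [hm, norm_zero, sub_zero, div_one, DiscInterp.tildeFn, intervalIntegral.integral_same,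
        mul_zero] at hbm
      rw [← hm, hfb]
      exact (Real.log_nonpos_iff (norm_nonneg _)).1 hbm
    -- Now `P 0 ≠ 0`, and `f - (f 0 / P 0) * P` has the same values at the `z n` and vanishes at
    -- `0`.
    · push Not at h0
      set P := DiscInterp.canonicalProduct z (DiscInterp.genus ψ)
      have hP0 : P 0 ≠ 0 := DiscInterp.canonicalProduct_ne_zero hz hg hs (by simp)
        fun n => (h0 n).symm
      obtain ⟨A, hA, hPA⟩ := DiscInterp.exists_norm_canonicalProduct_le hz hg hs
      have hgd : DifferentiableOn ℂ (fun w => f w - f 0 / P 0 * P w) (Metric.ball 0 1) :=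
        hfd.sub ((DiscInterp.differentiableOn_canonicalProduct hz hg hs).const_mul _)
      refine ⟨fun w => f w - f 0 / P 0 * P w, hgd, fun n => ?_,
        DiscInterp.exists_log_maxModulus_le_of_norm_zero_le hψ_nonneg hψ_mono hψ_unbdd hg hψ1
          (C := B + ‖f 0 / P 0‖ + A) (by positivity) (fun w hw => ?_) hgd ?_⟩
      · have : P (z n) = 0 := DiscInterp.canonicalProduct_apply_eq_zero hz hg hs n
        simp only
        rw [hfb, this, mul_zero, sub_zero]
      · set T := DiscInterp.partialSum (DiscInterp.dyadic ψ) (DiscInterp.level w)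
        have hT : 1 ≤ T := DiscInterp.one_le_partialSum hg _
        set k := ‖f 0 / P 0‖
        have hk : 0 ≤ k := norm_nonneg _
        have h1 : 1 ≤ Real.exp (A * T) := Real.one_le_exp (by positivity)
        have h2 : 1 ≤ Real.exp (B * T) := Real.one_le_exp (by positivity)
        have h3 : 1 + k ≤ Real.exp (k * T) := by nlinarith [Real.add_one_le_exp (k * T)]
        calc ‖f w - f 0 / P 0 * P w‖ ≤ ‖f w‖ + k * ‖P w‖ := by
              rw [← norm_mul]
              exact norm_sub_le _ _
          _ ≤ Real.exp (B * T) * Real.exp (A * T) + k * (Real.exp (B * T) * Real.exp (A * T)) := by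
              gcongr
              · exact (hfB w hw).trans (le_mul_of_one_le_right (by positivity) h1)
              · exact (hPA w hw).trans (le_mul_of_one_le_left (by positivity) h2)
          _ = (1 + k) * (Real.exp (B * T) * Real.exp (A * T)) := by ring
          _ ≤ Real.exp (k * T) * (Real.exp (B * T) * Real.exp (A * T)) := by gcongr
          _ = Real.exp ((B + k + A) * T) := by
              rw [← Real.exp_add, ← Real.exp_add]
              ring_nf
      · rw [div_mul_cancel₀ _ hP0, sub_self, norm_zero]
        exact zero_le_one
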